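/- **Setting.** Let $\mathcal Y\subset\mathbb R^d$ be a bounded open set with Lipschitz boundary, let $\mathcal S=\mathbb R^{d+Q}$, and let $L_1,\dots,L_Q$ be linear differential operators on $\mathcal Y$ of order at most $p$ with continuous coefficients. For a function $v$ on $\mathcal Y$ (of class $C^p$) and $y\in\mathcal Y$ put $$\Phi(v,y)=(y,\,L_1v(y),\dots,L_Qv(y))\in\mathcal S .$$ For $k\in\mathbb N_0$ and $\Omega$ open, $H^k(\Omega)$ is the $L^2$-based Sobolev space with $\|u\|_{H^k(\Omega)}^2=\sum_{|\alpha|\le k}\|D^\alpha u\|_{L^2(\Omega)}^2$; in particular $H^0=L^2$. Assume: * $\mathsf U$ is a continuous, positive definite and symmetric kernel on $\mathcal Y$ whose reproducing kernel Hilbert space (RKHS) $\mathcal U$ is compactly embedded in $H^\gamma(\mathcal Y)$ for some integer $\gamma>d/2+p$, and all elements $v$ of $\mathcal U$ satisfy the boundary condition $\mathscr B(v)=g$ on $\partial\mathcal Y$, where $\mathscr B$ is a boundary operator and $g$ is given; * $\mathsf P$ is a positive definite and symmetric kernel on $\mathcal S$ whose RKHS $\mathcal P$ consists of continuous functions and is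 compactly embedded in $H^\eta(\mathcal S)$ for some integer $\eta>(Q+d)/2$; * $P\in\mathcal P$, the function $\overline P:\mathcal S\to\mathbb R$ is continuous, and $(u^m,f^m)_{m\ge1}$ are pairs of functions on $\mathcal Y$ with $$(\overline P+P)(\Phi(u^m,y))=f^m(y)\ \ (y\in\mathcal Y),\qquad \mathscr B(u^m)=g\ \text{ on }\partial\mathcal Y .$$ For $m,N$ let $Y^m_N\subset\mathcal Y$ be a finite set of observation points and let $Y_{M,N}=\bigcup_{m=1}^MY^m_N$. Let $(\widehat u^1_{M,N},\dots,\widehat u^M_{M,N},\widehat P_{M,N})\in\mathcal U^M\times\mathcal P$ be any minimizer of $$\|G\|_{\mathcal P}^2+\sum_{m=1}^M\|v^m\|_{\mathcal U}^2$$ over all $(v^1,\dots,v^M,G)\in\mathcal U^M\times\mathcal P$ such that, for $m=1,\dots,M$, $$v^m(y)=u^m(y)\ \ (y\in Y^m_N),\qquad G(\Phi(v^m,y))=f^m(y)-\overline P(\Phi(v^m,y))\ \ (y\in Y_{M,N}).$$ Let $B\subset\mathcal S$ be a bounded open set with Lipschitz boundary, and let $S_{M,N}=\bigcup_{m=1}^M\Phi(u^m,Y_{M,N})$.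 Suppose that the fill distances satisfy $$\rho_{m,N}=\sup_{y\in\mathcal Y}\inf_{y'\in Y^m_N}\|y-y'\|_2\to0\ \ (N\to\infty)\ \text{ for every }m,\qquad \varrho_{M,N}(B)=\sup_{s\in B}\inf_{s'\in S_{M,N}\cap B}\|s-s'\|_2\to0\ \ (M,N\to\infty),$$ where an infimum over the empty set is $+\infty$. Finally, for a Mercer expansion $\mathsf U(y,y')=\sum_{i=1}^\infty\lambda_ie_i(y)e_i(y')$ with $\lambda_1\ge\lambda_2\ge\dots\ge0$ and continuous functions $e_i$ that are orthonormal in $L^2(\mathcal Y)$, let $\mathcal U^2$ be the space of all functions $\sum_{i:\lambda_i\ne0}c_ie_i$ with $\sum_{i:\lambda_i\neq0}\lambda_i^{-2}c_i^2<\infty$. **Proposition.** (a) Fix $M$. If $u^m\in\mathcal U$ for $m=1,\dots,M$, then for every $m\in\{1,\dots,M\}$, as $N\to\infty$, $\widehat u^m_{M,N}\to u^m$ pointwise in $\mathcal Y$ and in $H^{\gamma'}(\mathcal Y)$ for every integer $0\le\gamma'<\gamma$. (b) If $u^m\in\mathcal U^2$ for all $m$, then $\lim_{M\to\infty}\lim_{N\to\infty}\widehat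 P_{M,N}=P$ pointwise in $B$ and in $H^{\eta'}(B)$ for every integer $0\le\eta'<\eta$. That is, for every $M$ the limit $P_M:=\lim_{N\to\infty}\widehat P_{M,N}$ exists, pointwise in $B$ and in $H^{\eta'}(B)$, and $P_M\to P$ as $M\to\infty$ in the same senses. -/

import Mathlib

open MeasureTheory Filter Topology
open scoped ENNReal ContDiff

noncomputable section

namespace KEqL

/-- `ℝⁿ` with the Euclidean norm. -/
abbrev E (n : ℕ) : Type := EuclideanSpace ℝ (Fin n)

/-! ### Domains and fill distances -/

/-- `Ω` has Lipschitz boundary: near each boundary point it is, for some unit vector `e`, the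
strict epigraph in direction `e` of a Lipschitz function of the component orthogonal to `e`. -/
def HasLipschitzBoundary {n : ℕ} (Ω : Set (E n)) : Prop :=
  ∀ x ∈ frontier Ω, ∃ r > 0, ∃ e : E n, ‖e‖ = 1 ∧ ∃ (g : E n → ℝ) (K : NNReal),
    LipschitzWith K g ∧
      ∀ y ∈ Metric.ball x r, y ∈ Ω ↔ g (y - inner ℝ e y • e) < inner ℝ e y

/-- The fill distance `sup_{y ∈ A} inf_{x ∈ X} ‖y - x‖` of `X` in `A`
(it is `∞` if `X` is empty and `A` is not). -/
def fillDistance {n : ℕ} (A X : Set (E n)) : ℝ≥0∞ := ⨆ y ∈ A, Metric.infEDist y X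

/-! ### Multi-indices and classical derivatives -/

/-- The multi-indices `α ∈ ℕⁿ` with `|α| ≤ k`. -/
def multiIdx (n k : ℕ) : Finset (Fin n → ℕ) :=
  (Fintype.piFinset fun _ => Finset.range (k + 1)).filter fun α => ∑ i, α i ≤ k

lemma mem_multiIdx {n k : ℕ} {α : Fin n → ℕ} : α ∈ multiIdx n k ↔ ∑ i, α i ≤ k := by
  simp only [multiIdx, Finset.mem_filter, Fintype.mem_piFinset, Finset.mem_range,
    and_iff_right_iff_imp]
  intro h i
  have := Finset.single_le_sum (f := α) (fun j _ => Nat.zero_le _) (Finset.mem_univ i)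
  omega

/-- The multi-index `0`. -/
def zeroIdx (n k : ℕ) : multiIdx n k := ⟨0, by simp [mem_multiIdx]⟩

/-- The classical partial derivative `∂f/∂xᵢ`. -/
def partialDeriv {n : ℕ} (i : Fin n) (f : E n → ℝ) : E n → ℝ :=
  fun x => fderiv ℝ f x (EuclideanSpace.single i 1)

/-- The classical derivative `D^α f = ∂₁^{α₁} ⋯ ∂ₙ^{αₙ} f`. -/
def multiDeriv {n : ℕ} (α : Fin n → ℕ) (f : E n → ℝ) : E n → ℝ :=
  (List.finRange n).foldr (fun i g => (partialDeriv i)^[α i] g) f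

/-! ### Sobolev spaces of integer order -/

/-- Smooth functions with compact support inside `Ω`. -/
structure IsTest {n : ℕ} (Ω : Set (E n)) (φ : E n → ℝ) : Prop where
  contDiff : ContDiff ℝ ∞ φ
  compact : HasCompactSupport φ
  subset : tsupport φ ⊆ Ω

lemma contDiff_compact_iterate {n : ℕ} (i : Fin n) (k : ℕ) {φ : E n → ℝ}
    (h : ContDiff ℝ ∞ φ ∧ HasCompactSupport φ) :
    ContDiff ℝ ∞ ((partialDeriv i)^[k] φ) ∧ HasCompactSupport ((partialDeriv i)^[k] φ) := by
  induction k generalizing φ with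
  | zero => exact h
  | succ k ih =>
    rw [Function.iterate_succ_apply]
    refine ih ⟨?_, h.2.fderiv_apply ℝ _⟩
    exact (h.1.fderiv_right (m := ∞) (by simp)).clm_apply contDiff_const

lemma contDiff_compact_multiDeriv {n : ℕ} (α : Fin n → ℕ) {φ : E n → ℝ}
    (h : ContDiff ℝ ∞ φ ∧ HasCompactSupport φ) :
    ContDiff ℝ ∞ (multiDeriv α φ) ∧ HasCompactSupport (multiDeriv α φ) := by
  unfold multiDeriv
  induction List.finRange n with
  | nil => exact h
  | cons i l ih => exact contDiff_compact_iterate i (α i) ih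

/-- `g` is the weak derivative `D^α f` on `Ω` (used for `f, g ∈ L²(Ω)`). -/
def IsWeakDeriv {n : ℕ} (Ω : Set (E n)) (α : Fin n → ℕ) (f g : E n → ℝ) : Prop :=
  ∀ φ : E n → ℝ, IsTest Ω φ →
    ∫ x in Ω, f x * multiDeriv α φ x = (-1) ^ (∑ i, α i) * ∫ x in Ω, g x * φ x

lemma integrable_mul_of_compact {n : ℕ} {μ : Measure (E n)} [IsFiniteMeasureOnCompacts μ]
    (f : Lp ℝ 2 μ) {ψ : E n → ℝ} (h : ContDiff ℝ ∞ ψ ∧ HasCompactSupport ψ) :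
    Integrable (fun x => f x * ψ x) μ :=
  (Lp.memLp f).integrable_mul (q := 2) (h.1.continuous.memLp_of_hasCompactSupport h.2)

lemma isWeakDeriv_zero {n : ℕ} (Ω : Set (E n)) (α : Fin n → ℕ) :
    IsWeakDeriv Ω α (0 : Lp ℝ 2 (volume.restrict Ω)) (0 : Lp ℝ 2 (volume.restrict Ω)) := by
  intro φ _
  have h0 : ∀ ψ : E n → ℝ,
      ∫ x in Ω, (0 : Lp ℝ 2 (volume.restrict Ω)) x * ψ x = 0 := fun ψ => by
    refine integral_eq_zero_of_ae ?_
    filter_upwards [Lp.coeFn_zero ℝ 2 (volume.restrict Ω)] with x hx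
    simp only [hx, Pi.zero_apply, zero_mul]
  rw [h0, h0, mul_zero]

lemma isWeakDeriv_add {n : ℕ} {Ω : Set (E n)} {α : Fin n → ℕ}
    {f g f' g' : Lp ℝ 2 (volume.restrict Ω)}
    (h : IsWeakDeriv Ω α f g) (h' : IsWeakDeriv Ω α f' g') :
    IsWeakDeriv Ω α (f + f' : Lp ℝ 2 (volume.restrict Ω))
      (g + g' : Lp ℝ 2 (volume.restrict Ω)) := by
  intro φ hφ
  have key : ∀ (a b : Lp ℝ 2 (volume.restrict Ω)) (ψ : E n → ℝ),
      ContDiff ℝ ∞ ψ ∧ HasCompactSupport ψ →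
      ∫ x in Ω, (a + b : Lp ℝ 2 (volume.restrict Ω)) x * ψ x
        = (∫ x in Ω, a x * ψ x) + ∫ x in Ω, b x * ψ x := fun a b ψ hψ => by
    rw [← integral_add (integrable_mul_of_compact a hψ) (integrable_mul_of_compact b hψ)]
    refine integral_congr_ae ?_
    filter_upwards [Lp.coeFn_add a b] with x hx
    simp only [hx, Pi.add_apply, add_mul]
  have h1 : ContDiff ℝ ∞ φ ∧ HasCompactSupport φ := ⟨hφ.contDiff, hφ.compact⟩
  rw [key f f' _ (contDiff_compact_multiDeriv α h1), key g g' _ h1, h φ hφ, h' φ hφ, mul_add]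

lemma isWeakDeriv_smul {n : ℕ} {Ω : Set (E n)} {α : Fin n → ℕ} (c : ℝ)
    {f g : Lp ℝ 2 (volume.restrict Ω)} (h : IsWeakDeriv Ω α f g) :
    IsWeakDeriv Ω α (c • f : Lp ℝ 2 (volume.restrict Ω))
      (c • g : Lp ℝ 2 (volume.restrict Ω)) := by
  intro φ hφ
  have key : ∀ (a : Lp ℝ 2 (volume.restrict Ω)) (ψ : E n → ℝ),
      ∫ x in Ω, (c • a : Lp ℝ 2 (volume.restrict Ω)) x * ψ x
        = c * ∫ x in Ω, a x * ψ x := fun a ψ => by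
    rw [← integral_const_mul]
    refine integral_congr_ae ?_
    filter_upwards [Lp.coeFn_smul c a] with x hx
    simp [hx, mul_assoc]
  rw [key, key, h φ hφ]
  ring

/-- The Sobolev space `H^k(Ω)`: families `(w_α)_{|α| ≤ k}` in `L²(Ω)` such that `w_α` is the weak
derivative `D^α w₀`. An element is determined by `w₀`, and the norm inherited from the
`ℓ²`-product is `‖w‖² = ∑_{|α| ≤ k} ‖D^α w₀‖²_{L²(Ω)}`. -/
def SobolevSpace {n : ℕ} (k : ℕ) (Ω : Set (E n)) :
    Submodule ℝ (PiLp 2 fun _ : multiIdx n k => Lp ℝ 2 (volume.restrict Ω)) where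
  carrier := {w | ∀ α : multiIdx n k, IsWeakDeriv Ω α.1 (w (zeroIdx n k)) (w α)}
  add_mem' h h' α := isWeakDeriv_add (h α) (h' α)
  zero_mem' α := isWeakDeriv_zero Ω α.1
  smul_mem' c _ h α := isWeakDeriv_smul c (h α)

/-- `w ∈ H^k(Ω)` is the class of the function `f`. -/
def Represents {n k : ℕ} {Ω : Set (E n)} (w : SobolevSpace k Ω) (f : E n → ℝ) : Prop :=
  w.1 (zeroIdx n k) =ᵐ[volume.restrict Ω] f

/-- The norm `‖f‖_{H^k(Ω)}`, with value `∞` if (the class of) `f` is not in `H^k(Ω)`. -/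
def sobolevENorm {n : ℕ} (k : ℕ) (Ω : Set (E n)) (f : E n → ℝ) : ℝ≥0∞ :=
  ⨅ (w : SobolevSpace k Ω) (_ : Represents w f), ‖w‖ₑ

/-- The extension by zero of a function on `Ω`. -/
def ext0 {n : ℕ} {Ω : Set (E n)} (v : Ω → ℝ) : E n → ℝ := Function.extend Subtype.val v 0

/-- A normed space `V`, whose elements `v` are regarded as the functions `F v` on `Ω`, is compactly
embedded in `H^k(Ω)`: `v ↦ F v` is a bounded and compact linear map `V → H^k(Ω)`. -/
def CompactlyEmbedded {n : ℕ} {V : Type*} [NormedAddCommGroup V] [NormedSpace ℝ V]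
    (F : V → E n → ℝ) (k : ℕ) (Ω : Set (E n)) : Prop :=
  ∃ ι : V →L[ℝ] SobolevSpace k Ω, IsCompactOperator ι ∧ ∀ v, Represents (ι v) (F v)

/-! ### Reproducing kernels -/

/-- The (real-valued, positive semidefinite) kernel of a reproducing kernel Hilbert space. -/
def rkhsKernel (H : Type*) {X : Type*} [NormedAddCommGroup H] [InnerProductSpace ℝ H]
    [CompleteSpace H] [RKHS ℝ H X ℝ] (x y : X) : ℝ := RKHS.kernel H x y 1

/-- A Mercer expansion `K(x, x') = ∑ᵢ λᵢ eᵢ(x) eᵢ(x')`, with `λ` nonnegative and nonincreasing, and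
`eᵢ` continuous and orthonormal in `L²(Ω)`; indices with `λᵢ = 0` play no role. -/
structure IsMercerExpansion {n : ℕ} {Ω : Set (E n)} (K : Ω → Ω → ℝ) (lam : ℕ → ℝ)
    (e : ℕ → Ω → ℝ) : Prop where
  nonneg : ∀ i, 0 ≤ lam i
  antitone : Antitone lam
  continuous : ∀ i, Continuous (e i)
  memLp : ∀ i, lam i ≠ 0 → MemLp (ext0 (e i)) 2 (volume.restrict Ω)
  orthonormal : ∀ i j, lam i ≠ 0 → lam j ≠ 0 →
    ∫ x in Ω, ext0 (e i) x * ext0 (e j) x = if i = j then 1 else 0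
  hasSum : ∀ x x', HasSum (fun i => lam i * e i x * e i x') (K x x')

/-- The space `𝓗^θ` of the ladder generated by the kernel `K`: all functions `f = ∑ᵢ cᵢ eᵢ`, the
sum over the `i` with `λᵢ ≠ 0`, with `∑ᵢ λᵢ^{-θ} cᵢ² < ∞`. -/
def powerSpace {n : ℕ} {Ω : Set (E n)} (K : Ω → Ω → ℝ) (θ : ℝ) : Set (Ω → ℝ) :=
  {f | ∃ lam e, IsMercerExpansion K lam e ∧ ∃ c : ℕ → ℝ, (∀ i, lam i = 0 → c i = 0) ∧
    Summable (fun i => lam i ^ (-θ) * c i ^ 2) ∧ ∀ x, HasSum (fun i => c i * e i x) (f x)}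

/-! ### The learning problem -/

/-- A linear differential operator `∑_{|α| ≤ p} a_α D^α` on `Ω` of order at most `p`, with
continuous coefficients. -/
structure DiffOp {n : ℕ} (Ω : Set (E n)) (p : ℕ) where
  coeff : multiIdx n p → Ω → ℝ
  continuous_coeff : ∀ α, Continuous (coeff α)

/-- `(L v)(y)`. -/
def DiffOp.eval {n p : ℕ} {Ω : Set (E n)} (L : DiffOp Ω p) (v : Ω → ℝ) (y : Ω) : ℝ :=
  ∑ α, L.coeff α y * multiDeriv α.1 (ext0 v) y

variable {d p Q : ℕ} {𝓨 : Set (E d)}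

/-- `Φ(v, y) = (y, L₁ v(y), …, L_Q v(y)) ∈ 𝓢 = ℝ^{d + Q}`. -/
def Phi (L : Fin Q → DiffOp 𝓨 p) (v : 𝓨 → ℝ) (y : 𝓨) : E (d + Q) :=
  WithLp.toLp 2 (Fin.append (fun i => y.1 i) fun q => (L q).eval v y)

/-- The collocation points `Y_{M,N} = ⋃_{m < M} Y^m_N`. -/
def colloc (Y : ℕ → ℕ → Finset 𝓨) (M N : ℕ) : Set 𝓨 := ⋃ m < M, (Y m N : Set 𝓨)

/-- `S = ⋃_{m < M} Φ(u^m, Y_{M,N})`. -/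
def dataPoints (L : Fin Q → DiffOp 𝓨 p) (u : ℕ → 𝓨 → ℝ) (Y : ℕ → ℕ → Finset 𝓨) (M N : ℕ) :
    Set (E (d + Q)) :=
  ⋃ m < M, Phi L (u m) '' colloc Y M N

variable (HU HP : Type*) [NormedAddCommGroup HU] [InnerProductSpace ℝ HU] [RKHS ℝ HU 𝓨 ℝ]
  [NormedAddCommGroup HP] [InnerProductSpace ℝ HP] [RKHS ℝ HP (E (d + Q)) ℝ]

/-- The pairs `((v^m)_{m < M}, G)` that satisfy the constraints `v^m(Y^m_N) = u^m(Y^m_N)` and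
`G(Φ(v^m, y)) = f^m(y) - P̄(Φ(v^m, y))` for all `m < M` and `y ∈ Y_{M,N}`. -/
def feasible (L : Fin Q → DiffOp 𝓨 p) (Pbar : E (d + Q) → ℝ) (u f : ℕ → 𝓨 → ℝ)
    (Y : ℕ → ℕ → Finset 𝓨) (M N : ℕ) : Set ((Fin M → HU) × HP) :=
  {z | (∀ m : Fin M, ∀ y ∈ Y m N, z.1 m y = u m y) ∧
    ∀ m : Fin M, ∀ y ∈ colloc Y M N,
      z.2 (Phi L (z.1 m) y) = f m y - Pbar (Phi L (z.1 m) y)}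

/-- `z` is a minimizer of `‖G‖² + ∑_{m < M} ‖v^m‖²` over the feasible pairs. -/
def IsMinimizer (L : Fin Q → DiffOp 𝓨 p) (Pbar : E (d + Q) → ℝ) (u f : ℕ → 𝓨 → ℝ)
    (Y : ℕ → ℕ → Finset 𝓨) (M N : ℕ) (z : (Fin M → HU) × HP) : Prop :=
  z ∈ feasible HU HP L Pbar u f Y M N ∧
    IsMinOn (fun z : (Fin M → HU) × HP => ‖z.2‖ ^ 2 + ∑ m, ‖z.1 m‖ ^ 2)
      (feasible HU HP L Pbar u f Y M N) z

end KEqL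

end

open KEqL

/-! For (a): the exact tuple `(u^1, …, u^M, P)` is feasible, so the minimizers are bounded uniformly
in `N`. Since `y ↦ K(y, ·)` is continuous, bounded functions that agree with `u^m` on sets becoming
dense converge to it pointwise (`tendsto_apply_of_interpolation`), hence weakly in `𝓤`
(`weakTendsto_of_pointwise`). The compact embedding turns weak convergence into convergence in `H^γ`
(`WeakTendsto.compact`).

For (b): membership in `𝓤²` gives `u^m ∈ 𝓤` (`exists_eq_of_mem_powerSpace`). Fix `M`, put `Γ_M = ⋃
Φ(u^m, 𝓨)`, let `V_M` be the closed span of the representers of the points of `Γ_M`, and `π_M` the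
orthogonal projection onto `V_M`. The states converge in `H^γ` with `γ > d/2 + p`, so the points
`Φ(û^m, y)` converge (`tendsto_Phi`). The constraints then pass to the limit: every weak limit `c`
of the learned equations equals `P` on `Γ_M` (`apply_eq_of_weakTendsto`). Also `π_M P = P` on `Γ_M`,
so `(u, π_M P)` is a competitor, while `c - π_M P` is orthogonal to `V_M`, which gives `⟨π_M P, c⟩ =
‖π_M P‖²`. With the upper bound on the objective this forces norm convergence to `π_M P`
(`tendsto_of_norm_sq_add_le`). As `M` grows the `V_M` increase, so `π_M P` converges in norm to some
`P_∞`, which equals `P` on every `Γ_M` and, by density and continuity, on `B`.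

The analytic input is an interior Sobolev estimate for classical derivatives
(`exists_multiDeriv_sub_le`): cut off, take Fourier transforms, apply Cauchy–Schwarz and invert.
Weak limits are taken along ultrafilters, so no subsequences are extracted. -/

namespace KEqL

open scoped FourierTransform NNReal

/-! ### Plancherel for `L¹ ∩ L²` -/

section Plancherel

variable {V : Type*} [NormedAddCommGroup V] [InnerProductSpace ℝ V] [FiniteDimensional ℝ V]
  [MeasurableSpace V] [BorelSpace V]

lemma continuous_fourier {h : V → ℂ} (h1 : Integrable h) : Continuous (𝓕 h) :=
  VectorFourier.fourierIntegral_continuous Real.continuous_fourierChar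
    (by exact continuous_inner) h1

/-- The Fourier integral of an `L¹ ∩ L²` function represents its `L²` Fourier transform. -/
lemma fourier_toLp_ae_eq {h : V → ℂ} (h1 : Integrable h) (h2 : MemLp h 2) :
    (𝓕 (h2.toLp h) : Lp ℂ 2 (volume : Measure V)) =ᵐ[volume] 𝓕 h := by
  refine ae_eq_of_integral_contDiff_smul_eq
    ((Lp.memLp _).locallyIntegrable (by norm_num))
    (continuous_fourier h1).locallyIntegrable fun g hg hgc => ?_
  have hg₁ : HasCompactSupport (Complex.ofRealCLM ∘ g) := hgc.comp_left rfl
  have hg₂ : ContDiff ℝ ∞ (Complex.ofRealCLM ∘ g) := by fun_prop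
  set G : SchwartzMap V ℂ := hg₁.toSchwartzMap hg₂ with hG
  have hGg : ∀ x, G x = (g x : ℂ) := fun x => by simp [hG]
  -- The `L²` transform is also the distributional one, so pairing with `G` moves the transform onto
  -- `G`; `e2` does the same for the Fourier integral, and the two pairings coincide.
  have e1 := congrArg (fun T => T G) (Lp.fourier_toTemperedDistribution_eq (h2.toLp h))
  simp only [TemperedDistribution.fourier_apply, Lp.toTemperedDistribution_apply] at e1
  have e2 : ∫ ξ, (𝓕 (G : V → ℂ) ξ) • h ξ = ∫ x, G x • 𝓕 h x := by
    have := VectorFourier.integral_fourierIntegral_smul_eq_flip (μ := (volume : Measure V))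
      (ν := (volume : Measure V)) (L := innerₗ V) (f := (G : V → ℂ)) (g := h)
      Real.continuous_fourierChar continuous_inner G.integrable h1
    rwa [flip_innerₗ] at this
  calc ∫ x, g x • (𝓕 (h2.toLp h) : Lp ℂ 2 (volume : Measure V)) x
      = ∫ x, G x • (𝓕 (h2.toLp h) : Lp ℂ 2 (volume : Measure V)) x := by
        simp only [hGg, Complex.real_smul, smul_eq_mul]
    _ = ∫ x, (𝓕 G) x • (h2.toLp h) x := e1.symm
    _ = ∫ ξ, (𝓕 (G : V → ℂ) ξ) • h ξ := by
        refine integral_congr_ae ?_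
        filter_upwards [h2.coeFn_toLp] with x hx
        rw [hx, SchwartzMap.fourier_coe]
    _ = ∫ x, G x • 𝓕 h x := e2
    _ = ∫ x, g x • 𝓕 h x := by simp only [hGg, Complex.real_smul, smul_eq_mul]

lemma eLpNorm_fourier {h : V → ℂ} (h1 : Integrable h) (h2 : MemLp h 2) :
    eLpNorm (𝓕 h) 2 volume = eLpNorm h 2 volume := by
  rw [← eLpNorm_congr_ae (fourier_toLp_ae_eq h1 h2), ← eLpNorm_congr_ae h2.coeFn_toLp,
    ← Lp.enorm_def, ← Lp.enorm_def, ← ofReal_norm, ← ofReal_norm, Lp.norm_fourier_eq]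

end Plancherel

/-! ### Localized `L²` functions -/

section Cutoff

variable {n : ℕ} {Ω : Set (E n)}

/-- The product of a test function with an `L²(Ω)` function, as a complex function on `ℝⁿ`. -/
def cut (χ : E n → ℝ) (w : E n → ℝ) : E n → ℂ := fun x => ((χ x * w x : ℝ) : ℂ)

lemma IsTest.contDiff_compact {χ : E n → ℝ} (hχ : IsTest Ω χ) :
    ContDiff ℝ ∞ χ ∧ HasCompactSupport χ := ⟨hχ.contDiff, hχ.compact⟩

lemma IsTest.eq_zero {χ : E n → ℝ} (hχ : IsTest Ω χ) {x : E n} (hx : x ∉ Ω) : χ x = 0 := by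
  by_contra h
  exact hx (hχ.subset (subset_tsupport _ h))

lemma IsTest.partialDeriv {χ : E n → ℝ} (hχ : IsTest Ω χ) (i : Fin n) :
    IsTest Ω (partialDeriv i χ) := by
  have := contDiff_compact_iterate i 1 hχ.contDiff_compact
  refine ⟨this.1, this.2, ?_⟩
  exact (tsupport_fderiv_apply_subset ℝ _).trans hχ.subset

lemma IsTest.exists_bound {χ : E n → ℝ} (hχ : IsTest Ω χ) : ∃ C : ℝ≥0, ∀ x, ‖χ x‖₊ ≤ C := by
  obtain ⟨C, hC⟩ := hχ.compact.exists_bound_of_continuous hχ.contDiff.continuous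
  exact ⟨C.toNNReal, fun x => by
    rw [← NNReal.coe_le_coe, coe_nnnorm]; exact (hC x).trans (Real.le_coe_toNNReal _)⟩

/-- A test function vanishes off `Ω`, so the arbitrary values there of a representative of an
`L²(Ω)` class are harmless. -/
lemma cut_eq_indicator {χ : E n → ℝ} (hχ : IsTest Ω χ) (w : E n → ℝ) :
    cut χ w = Ω.indicator (cut χ w) := by
  funext x
  by_cases hx : x ∈ Ω
  · simp [hx]
  · simp [hx, cut, hχ.eq_zero hx]

lemma integrable_cut {χ : E n → ℝ} (hχ : IsTest Ω χ) (w : Lp ℝ 2 (volume.restrict Ω)) :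
    Integrable (cut χ w) := by
  refine (integrableOn_iff_integrable_of_support_subset (s := Ω) fun x hx => ?_).1 ?_
  · by_contra h
    exact hx (by simp [cut, hχ.eq_zero h])
  · refine ((integrable_mul_of_compact w hχ.contDiff_compact).ofReal (𝕜 := ℂ)).congr ?_
    exact Eventually.of_forall fun x => by simp [cut, mul_comm]

lemma eLpNorm_cut_le (hΩ : IsOpen Ω) {χ : E n → ℝ} (hχ : IsTest Ω χ) {C : ℝ≥0}
    (hC : ∀ x, ‖χ x‖₊ ≤ C) (w : Lp ℝ 2 (volume.restrict Ω)) :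
    eLpNorm (cut χ w) 2 volume ≤ C * ‖w‖ₑ := by
  rw [cut_eq_indicator hχ, eLpNorm_indicator_eq_eLpNorm_restrict hΩ.measurableSet, Lp.enorm_def]
  refine eLpNorm_le_nnreal_smul_eLpNorm_of_ae_le_mul (c := C)
    (Eventually.of_forall fun x => ?_) 2
  simp only [cut, Complex.nnnorm_real, nnnorm_mul]
  gcongr
  exact hC x

lemma memLp_cut (hΩ : IsOpen Ω) {χ : E n → ℝ} (hχ : IsTest Ω χ)
    (w : Lp ℝ 2 (volume.restrict Ω)) : MemLp (cut χ w) 2 := by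
  obtain ⟨C, hC⟩ := hχ.exists_bound
  refine ⟨(integrable_cut hχ w).1, (eLpNorm_cut_le hΩ hχ hC w).trans_lt ?_⟩
  exact ENNReal.mul_lt_top ENNReal.coe_lt_top enorm_lt_top

end Cutoff

/-! ### Fourier transform of localized weak derivatives -/

section WeakDeriv

variable {n : ℕ} {Ω : Set (E n)}

/-- `w'` is the first order weak derivative `∂w/∂xᵢ` on `Ω`. -/
def IsWeakPartial (Ω : Set (E n)) (i : Fin n) (w w' : E n → ℝ) : Prop :=
  ∀ φ : E n → ℝ, IsTest Ω φ → ∫ x in Ω, w x * partialDeriv i φ x = - ∫ x in Ω, w' x * φ x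

/-- The complex character `x ↦ exp(-2πi⟨x, ξ⟩)`. -/
noncomputable def expNeg (ξ : E n) (x : E n) : ℂ := (Real.fourierChar (-inner ℝ x ξ) : ℂ)

lemma contDiff_expNeg (ξ : E n) : ContDiff ℝ ∞ (expNeg ξ) := by
  have : expNeg ξ = fun x => Complex.exp (↑(2 * Real.pi * (-inner ℝ x ξ)) * Complex.I) := by
    funext x; rw [expNeg, Real.fourierChar_apply]
  rw [this]
  have h1 : ContDiff ℝ ∞ fun x : E n => 2 * Real.pi * (-inner ℝ x ξ) :=
    contDiff_const.mul (contDiff_id.inner ℝ contDiff_const).neg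
  exact ((Complex.ofRealCLM.contDiff.comp h1).mul contDiff_const).cexp

lemma fderiv_expNeg (ξ x : E n) (i : Fin n) :
    fderiv ℝ (expNeg ξ) x (EuclideanSpace.single i 1)
      = -(2 * Real.pi * Complex.I) * ξ i * expNeg ξ x := by
  have := Real.fderiv_fourierChar_neg_bilinear_right_apply (innerSL ℝ (E := E n)) ξ x
    (EuclideanSpace.single i 1)
  change fderiv ℝ (fun w => (Real.fourierChar (-inner ℝ ξ w) : ℂ)) x _
    = -2 * Real.pi * Complex.I * (inner ℝ ξ (EuclideanSpace.single i 1) : ℝ)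
      * Real.fourierChar (-inner ℝ ξ x) at this
  have h2 : expNeg ξ = fun w => (Real.fourierChar (-inner ℝ ξ w) : ℂ) := by
    funext w; rw [expNeg, real_inner_comm]
  rw [h2, this]
  simp [EuclideanSpace.inner_single_right]

lemma fourier_cut {χ : E n → ℝ} (hχ : IsTest Ω χ) (hΩ : IsOpen Ω) (w : E n → ℝ) (ξ : E n) :
    𝓕 (cut χ w) ξ = ∫ x in Ω, (w x : ℂ) * (χ x * expNeg ξ x) := by
  rw [Real.fourier_eq, ← integral_indicator hΩ.measurableSet]
  refine integral_congr_ae (Eventually.of_forall fun x => ?_)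
  by_cases hx : x ∈ Ω
  · simp [hx, cut, expNeg, Circle.smul_def]; ring
  · simp [hx, cut, hχ.eq_zero hx]

/-- The defining identity of a weak derivative, tested with `χ` times a real smooth function. -/
lemma IsWeakPartial.mul_test {i : Fin n} {w w' : Lp ℝ 2 (volume.restrict Ω)}
    (h : IsWeakPartial Ω i w w') {χ : E n → ℝ} (hχ : IsTest Ω χ) {c : E n → ℝ}
    (hc : ContDiff ℝ ∞ c) :
    (∫ x in Ω, w x * (χ x * fderiv ℝ c x (EuclideanSpace.single i 1)))
      = -(∫ x in Ω, w' x * (χ x * c x)) - ∫ x in Ω, w x * (partialDeriv i χ x * c x) := by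
  have ht : ∀ {χ : E n → ℝ} {c : E n → ℝ}, IsTest Ω χ → ContDiff ℝ ∞ c →
      IsTest Ω (fun x => χ x * c x) := fun {χ c} hχ hc =>
    ⟨hχ.contDiff.mul hc, hχ.compact.mul_right,
      (tsupport_mul_subset_left (f := χ) (g := c)).trans hχ.subset⟩
  have h1 := h _ (ht hχ hc)
  have hd : ∀ x, partialDeriv i (fun x => χ x * c x) x
      = χ x * fderiv ℝ c x (EuclideanSpace.single i 1) + partialDeriv i χ x * c x := by
    intro x
    have := fderiv_fun_mul (hχ.contDiff.differentiable (by simp) x)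
      (hc.differentiable (by simp) x)
    simp only [partialDeriv, this, add_apply, smul_apply, smul_eq_mul]
    ring
  have hc' : ContDiff ℝ ∞ fun x => fderiv ℝ c x (EuclideanSpace.single i 1) :=
    (hc.fderiv_right (m := ∞) (by simp)).clm_apply contDiff_const
  simp only [hd, mul_add] at h1
  rw [integral_add (integrable_mul_of_compact w (ht hχ hc').contDiff_compact)
    (integrable_mul_of_compact w (ht (hχ.partialDeriv i) hc).contDiff_compact)] at h1
  linarith

lemma integrable_mul_test {χ : E n → ℝ} (hχ : IsTest Ω χ) (w : Lp ℝ 2 (volume.restrict Ω))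
    {c : E n → ℂ} (hc : Continuous c) :
    Integrable (fun x => (w x : ℂ) * (χ x * c x)) (volume.restrict Ω) := by
  have h1 : MemLp (fun x => (χ x : ℂ) * c x) 2 (volume.restrict Ω) := by
    refine Continuous.memLp_of_hasCompactSupport ?_ ?_
    · exact (Complex.continuous_ofReal.comp hχ.contDiff.continuous).mul hc
    · exact (hχ.compact.comp_left (g := fun r : ℝ => (r : ℂ)) Complex.ofReal_zero).mul_right
  exact (MemLp.ofReal (K := ℂ) (Lp.memLp w)).integrable_mul (q := 2) h1

/-- Integration by parts against `χ` times the character: differentiating the exponential produces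
the factor `ξ i`, differentiating `χ` produces the second term on the right. -/
lemma fourier_cut_partial (hΩ : IsOpen Ω) {i : Fin n} {w w' : Lp ℝ 2 (volume.restrict Ω)}
    (h : IsWeakPartial Ω i w w') {χ : E n → ℝ} (hχ : IsTest Ω χ) (ξ : E n) :
    2 * Real.pi * Complex.I * (ξ i * 𝓕 (cut χ w) ξ)
      = 𝓕 (cut χ w') ξ + 𝓕 (cut (partialDeriv i χ) w) ξ := by
  rw [fourier_cut hχ hΩ, fourier_cut hχ hΩ, fourier_cut (hχ.partialDeriv i) hΩ]
  have hsm := contDiff_expNeg ξ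
  have hdiff : ∀ x, HasFDerivAt (expNeg ξ) (fderiv ℝ (expNeg ξ) x) x := fun x =>
    (hsm.differentiable (by simp) x).hasFDerivAt
  have hcd : Continuous fun x => fderiv ℝ (expNeg ξ) x (EuclideanSpace.single i 1) :=
    ((hsm.fderiv_right (m := ∞) (by simp)).clm_apply contDiff_const).continuous
  have key : (∫ x in Ω, (w x : ℂ) *
        (χ x * fderiv ℝ (expNeg ξ) x (EuclideanSpace.single i 1)))
      = -(∫ x in Ω, (w' x : ℂ) * (χ x * expNeg ξ x))
        - ∫ x in Ω, (w x : ℂ) * (partialDeriv i χ x * expNeg ξ x) := by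
    have I1 := integrable_mul_test hχ w hcd
    have I2 := integrable_mul_test hχ w' hsm.continuous
    have I3 := integrable_mul_test (hχ.partialDeriv i) w hsm.continuous
    -- Test functions are real-valued, so the identity is applied separately to the real and
    -- imaginary parts of the exponential.
    have hre : ∀ x, fderiv ℝ (fun x => (expNeg ξ x).re) x (EuclideanSpace.single i 1)
        = (fderiv ℝ (expNeg ξ) x (EuclideanSpace.single i 1)).re := fun x => by
      have := (Complex.reCLM.hasFDerivAt.comp x (hdiff x)).fderiv
      exact congrArg (fun T => T (EuclideanSpace.single i 1)) this
    have him : ∀ x, fderiv ℝ (fun x => (expNeg ξ x).im) x (EuclideanSpace.single i 1)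
        = (fderiv ℝ (expNeg ξ) x (EuclideanSpace.single i 1)).im := fun x => by
      have := (Complex.imCLM.hasFDerivAt.comp x (hdiff x)).fderiv
      exact congrArg (fun T => T (EuclideanSpace.single i 1)) this
    have r1 := h.mul_test hχ (c := fun x => (expNeg ξ x).re) (Complex.reCLM.contDiff.comp hsm)
    have r2 := h.mul_test hχ (c := fun x => (expNeg ξ x).im) (Complex.imCLM.contDiff.comp hsm)
    have cre : ∀ {F : E n → ℂ}, Integrable F (volume.restrict Ω) →
        (∫ x in Ω, F x).re = ∫ x in Ω, (F x).re := fun hF =>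
      (integral_re hF).symm
    have cim : ∀ {F : E n → ℂ}, Integrable F (volume.restrict Ω) →
        (∫ x in Ω, F x).im = ∫ x in Ω, (F x).im := fun hF =>
      (integral_im hF).symm
    apply Complex.ext
    · rw [Complex.sub_re, Complex.neg_re, cre I1, cre I2, cre I3]
      simpa only [Complex.re_ofReal_mul, hre] using r1
    · rw [Complex.sub_im, Complex.neg_im, cim I1, cim I2, cim I3]
      simpa only [Complex.im_ofReal_mul, him] using r2
  simp only [fderiv_expNeg] at key
  have e : (∫ x in Ω, (w x : ℂ) * (χ x * (-(2 * Real.pi * Complex.I) * ξ i * expNeg ξ x)))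
      = -(2 * Real.pi * Complex.I) * ξ i * ∫ x in Ω, (w x : ℂ) * (χ x * expNeg ξ x) := by
    rw [← integral_const_mul]
    congr 1; funext x; ring
  rw [e] at key
  linear_combination -key

/-- Weighted `L²` bound for the Fourier transform of a localized function with `k` weak
derivatives in the direction `i`. -/
lemma exists_eLpNorm_pow_mul_fourier_cut_le (hΩ : IsOpen Ω) (i : Fin n) (k : ℕ) :
    ∀ χ : E n → ℝ, IsTest Ω χ → ∃ C : ℝ≥0, ∀ (w : ℕ → Lp ℝ 2 (volume.restrict Ω)) (R : ℝ≥0∞),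
      -- The quantifier over `χ` stays inside the induction: order `k + 1` for `χ` uses order `k`
      -- for both `χ` and its partial derivative. The constant precedes `w`, so it is uniform.
      (∀ j < k, IsWeakPartial Ω i (w j) (w (j + 1))) → (∀ j ≤ k, ‖w j‖ₑ ≤ R) →
      eLpNorm (fun ξ => (ξ i : ℂ) ^ k * 𝓕 (cut χ (w 0)) ξ) 2 volume ≤ C * R := by
  induction k with
  | zero =>
    intro χ hχ
    obtain ⟨C, hC⟩ := hχ.exists_bound
    refine ⟨C, fun w R _ hR => ?_⟩
    simp only [pow_zero, one_mul]
    rw [eLpNorm_fourier (integrable_cut hχ _) (memLp_cut hΩ hχ _)]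
    exact (eLpNorm_cut_le hΩ hχ hC _).trans (by gcongr; exact hR 0 le_rfl)
  | succ k ih =>
    intro χ hχ
    obtain ⟨C₁, h₁⟩ := ih χ hχ
    obtain ⟨C₂, h₂⟩ := ih _ (hχ.partialDeriv i)
    refine ⟨‖(2 * Real.pi * Complex.I : ℂ)⁻¹‖₊ * (C₁ + C₂), fun w R hw hR => ?_⟩
    have hpi : (2 * Real.pi * Complex.I : ℂ) ≠ 0 := by simp [Real.pi_ne_zero]
    have e : (fun ξ : E n => (ξ i : ℂ) ^ (k + 1) * 𝓕 (cut χ (w 0)) ξ)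
        = (2 * Real.pi * Complex.I : ℂ)⁻¹ • ((fun ξ : E n => (ξ i : ℂ) ^ k * 𝓕 (cut χ (w 1)) ξ)
          + fun ξ : E n => (ξ i : ℂ) ^ k * 𝓕 (cut (partialDeriv i χ) (w 0)) ξ) := by
      funext ξ
      have := fourier_cut_partial hΩ (hw 0 (Nat.succ_pos k)) hχ ξ
      simp only [Pi.smul_apply, Pi.add_apply, smul_eq_mul]
      rw [← mul_add, ← this, pow_succ]
      field_simp
    have hm : ∀ {χ : E n → ℝ} (_ : IsTest Ω χ) (w : Lp ℝ 2 (volume.restrict Ω)),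
        AEStronglyMeasurable (fun ξ : E n => (ξ i : ℂ) ^ k * 𝓕 (cut χ w) ξ) volume := by
      intro χ hχ w
      have := continuous_fourier (integrable_cut hχ w)
      exact Continuous.aestronglyMeasurable (by fun_prop)
    rw [e, eLpNorm_const_smul, ENNReal.coe_mul, ENNReal.coe_add, mul_assoc _ _ R, add_mul]
    refine mul_le_mul' le_rfl ?_
    · refine (eLpNorm_add_le (hm hχ _) (hm (hχ.partialDeriv i) _) (by norm_num)).trans ?_
      refine add_le_add (h₁ (fun j => w (j + 1)) R (fun j hj => hw _ (by omega))
        (fun j hj => hR _ (by omega))) (h₂ w R (fun j hj => hw _ (by omega))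
        (fun j hj => hR _ (by omega)))

end WeakDeriv

/-! ### Interior Sobolev embedding -/

section Sobolev

variable {n : ℕ} {Ω : Set (E n)}

lemma multiDeriv_single (i : Fin n) (j : ℕ) (φ : E n → ℝ) :
    multiDeriv (Pi.single i j) φ = (partialDeriv i)^[j] φ := by
  have key : ∀ l : List (Fin n), l.Nodup →
      l.foldr (fun i' g => (partialDeriv i')^[(Pi.single i j : Fin n → ℕ) i'] g) φ
        = if i ∈ l then (partialDeriv i)^[j] φ else φ := by
    intro l hl
    induction l with
    | nil => simp
    | cons a l ih =>
      rw [List.nodup_cons] at hl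
      rw [List.foldr_cons, ih hl.2]
      by_cases hai : a = i
      · subst hai
        simp [hl.1]
      · simp [Ne.symm hai]
  rw [multiDeriv, key _ (List.nodup_finRange n)]
  simp

/-- The pure derivatives in direction `i` of an element of `H^k(Ω)`. -/
noncomputable def pureDeriv {k : ℕ} (w : SobolevSpace k Ω) (i : Fin n) (j : ℕ) :
    Lp ℝ 2 (volume.restrict Ω) :=
  if h : j ≤ k then w.1 ⟨Pi.single i j, by simpa [mem_multiIdx] using h⟩ else 0

lemma pureDeriv_zero {k : ℕ} (w : SobolevSpace k Ω) (i : Fin n) :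
    pureDeriv w i 0 = w.1 (zeroIdx n k) := by
  simp [pureDeriv, zeroIdx]

lemma enorm_pureDeriv_le {k : ℕ} (w : SobolevSpace k Ω) (i : Fin n) (j : ℕ) :
    ‖pureDeriv w i j‖ₑ ≤ ‖w‖ₑ := by
  rw [pureDeriv]
  split_ifs
  · rw [enorm_le_iff_norm_le]
    exact PiLp.norm_apply_le w.1 _
  · simp

/-- Each component of `w` is a weak derivative of the zeroth one only. Testing order `j` with `∂ᵢφ`
and order `j + 1` with `φ` gives the same integral, which links consecutive orders. -/
lemma isWeakPartial_pureDeriv {k : ℕ} (w : SobolevSpace k Ω) (i : Fin n) {j : ℕ} (hj : j < k) :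
    IsWeakPartial Ω i (pureDeriv w i j) (pureDeriv w i (j + 1)) := by
  intro φ hφ
  have h0 : ∀ j' (hj' : j' ≤ k) (ψ : E n → ℝ), IsTest Ω ψ →
      ∫ x in Ω, w.1 (zeroIdx n k) x * (partialDeriv i)^[j'] ψ x
        = (-1) ^ j' * ∫ x in Ω, pureDeriv w i j' x * ψ x := by
    intro j' hj' ψ hψ
    have := w.2 ⟨Pi.single i j', by simpa [mem_multiIdx] using hj'⟩ ψ hψ
    simp only [multiDeriv_single] at this
    rw [this, pureDeriv, dif_pos hj']
    simp
  have h1 := h0 j hj.le _ (hφ.partialDeriv i)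
  have h2 := h0 (j + 1) hj φ hφ
  rw [Function.iterate_succ_apply, h1, pow_succ, mul_assoc] at h2
  have := mul_left_cancel₀ (pow_ne_zero j (by norm_num : (-1 : ℝ) ≠ 0)) h2
  rw [this]; ring

/-- Replaces the Sobolev weight by pure powers of single coordinates, so that only pure derivatives
have to be transformed. -/
lemma one_add_norm_pow_le (k : ℕ) (ξ : E n) :
    (1 + ‖ξ‖) ^ k ≤ ((n : ℝ) + 1) ^ k * (1 + ∑ i, |ξ i| ^ k) := by
  have hpos : ∀ i, 0 ≤ |ξ i| ^ k := fun i => by positivity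
  have hsum : 0 ≤ ∑ i, |ξ i| ^ k := Finset.sum_nonneg fun i _ => hpos i
  -- `t` is the larger of `1` and the largest `|ξ i|`.
  obtain ⟨t, ht0, ht, htk⟩ : ∃ t : ℝ, 1 ≤ t ∧ (∀ i, |ξ i| ≤ t) ∧
      t ^ k ≤ 1 + ∑ i, |ξ i| ^ k := by
    by_cases h : ∃ i, 1 ≤ |ξ i|
    · obtain ⟨i₀, h₀⟩ := h
      obtain ⟨i, -, hi⟩ := Finset.exists_max_image Finset.univ (fun i => |ξ i|) ⟨i₀, by simp⟩
      refine ⟨|ξ i|, h₀.trans (hi i₀ (by simp)), fun j => hi j (by simp), ?_⟩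
      have := Finset.single_le_sum (f := fun i => |ξ i| ^ k) (fun j _ => hpos j)
        (Finset.mem_univ i)
      simp only at this
      linarith
    · push Not at h
      exact ⟨1, le_rfl, fun i => (h i).le, by simpa using hsum⟩
  have hn : ‖ξ‖ ≤ n * t := by
    have h1 : ‖ξ‖ ≤ ∑ i, |ξ i| := by
      conv_lhs => rw [← (EuclideanSpace.basisFun (Fin n) ℝ).sum_repr ξ]
      refine (norm_sum_le _ _).trans (Finset.sum_le_sum fun i _ => ?_)
      simp [norm_smul]
    refine h1.trans ((Finset.sum_le_sum fun i _ => ht i).trans ?_)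
    simp
  calc (1 + ‖ξ‖) ^ k ≤ ((n + 1) * t) ^ k := by gcongr; linarith
    _ = ((n : ℝ) + 1) ^ k * t ^ k := mul_pow _ _ _
    _ ≤ _ := by gcongr

/-- `(1 + |ξ|)^k` times the Fourier transform of a localized `H^k(Ω)` function is in `L²`. -/
lemma exists_eLpNorm_weight_mul_fourier_le (hΩ : IsOpen Ω) (k : ℕ) {χ : E n → ℝ}
    (hχ : IsTest Ω χ) : ∃ C : ℝ≥0, ∀ w : SobolevSpace k Ω,
      eLpNorm (fun ξ => ((1 + ‖ξ‖) ^ k : ℝ) • 𝓕 (cut χ (w.1 (zeroIdx n k))) ξ) 2 volume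
        ≤ C * ‖w‖ₑ := by
  choose C hC using fun i => exists_eLpNorm_pow_mul_fourier_cut_le hΩ i k χ hχ
  obtain ⟨C₀, hC₀⟩ := hχ.exists_bound
  refine ⟨((n : ℝ≥0) + 1) ^ k * (C₀ + ∑ i, C i), fun w => ?_⟩
  set F := 𝓕 (cut χ (w.1 (zeroIdx n k))) with hF
  have hFc : Continuous F := continuous_fourier (integrable_cut hχ _)
  have hb : ∀ ξ : E n, ‖((1 + ‖ξ‖) ^ k : ℝ) • F ξ‖₊
      ≤ ((n : ℝ≥0) + 1) ^ k * ‖‖F ξ‖ + ∑ i, ‖(ξ i : ℂ) ^ k * F ξ‖‖₊ := by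
    intro ξ
    rw [← NNReal.coe_le_coe]
    push_cast
    rw [norm_smul, Real.norm_of_nonneg (by positivity : (0 : ℝ) ≤ (1 + ‖ξ‖) ^ k),
      Real.norm_of_nonneg (by positivity : 0 ≤ ‖F ξ‖ + ∑ i, ‖(ξ i : ℂ) ^ k * F ξ‖)]
    have := mul_le_mul_of_nonneg_right (one_add_norm_pow_le k ξ) (norm_nonneg (F ξ))
    refine this.trans (le_of_eq ?_)
    simp only [norm_mul, norm_pow, Complex.norm_real, Real.norm_eq_abs]
    rw [← Finset.sum_mul]
    ring
  have hm : ∀ i, AEStronglyMeasurable (fun ξ : E n => ‖(ξ i : ℂ) ^ k * F ξ‖) volume := fun i =>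
    Continuous.aestronglyMeasurable (by fun_prop)
  refine (eLpNorm_le_nnreal_smul_eLpNorm_of_ae_le_mul (Eventually.of_forall hb) 2).trans ?_
  rw [ENNReal.smul_def, smul_eq_mul, ENNReal.coe_mul, mul_assoc _ _ ‖w‖ₑ]
  refine mul_le_mul' le_rfl ?_
  have e : (fun ξ : E n => ‖F ξ‖ + ∑ i, ‖(ξ i : ℂ) ^ k * F ξ‖)
      = (fun ξ => ‖F ξ‖) + ∑ i, fun ξ : E n => ‖(ξ i : ℂ) ^ k * F ξ‖ := by
    funext ξ; simp
  refine (congrArg (fun G => eLpNorm G 2 volume) e).trans_le ?_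
  refine (eLpNorm_add_le hFc.norm.aestronglyMeasurable
    (Finset.aestronglyMeasurable_sum _ fun i _ => hm i) (by norm_num)).trans ?_
  rw [ENNReal.coe_add, add_mul]
  refine add_le_add ?_ ?_
  · rw [eLpNorm_norm, hF, eLpNorm_fourier (integrable_cut hχ _) (memLp_cut hΩ hχ _)]
    refine (eLpNorm_cut_le hΩ hχ hC₀ _).trans ?_
    gcongr
    exact enorm_le_iff_norm_le.2 (PiLp.norm_apply_le w.1 _)
  · refine (eLpNorm_sum_le (fun i _ => hm i) (by norm_num)).trans ?_
    rw [ENNReal.ofNNReal_finsetSum, Finset.sum_mul]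
    refine Finset.sum_le_sum fun i _ => ?_
    rw [eLpNorm_norm]
    have := hC i (pureDeriv w i) ‖w‖ₑ (fun j hj => isWeakPartial_pureDeriv w i hj)
      (fun j _ => enorm_pureDeriv_le w i j)
    rwa [pureDeriv_zero] at this

/-- For `k > n/2 + p`, `(1 + |ξ|)^p` times the Fourier transform of a localized `H^k(Ω)` function
is in `L¹`. -/
lemma exists_integral_weight_mul_fourier_le (hΩ : IsOpen Ω) {k p : ℕ}
    (hk : (n : ℝ) / 2 + p < k) {χ : E n → ℝ} (hχ : IsTest Ω χ) :
    ∃ C : ℝ≥0, ∀ w : SobolevSpace k Ω,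
      eLpNorm (fun ξ => ((1 + ‖ξ‖) ^ p : ℝ) • 𝓕 (cut χ (w.1 (zeroIdx n k))) ξ) 1 volume
        ≤ C * ‖w‖ₑ := by
  obtain ⟨C, hC⟩ := exists_eLpNorm_weight_mul_fourier_le hΩ k hχ
  have hpk : p ≤ k := by
    have : (p : ℝ) < k := lt_of_le_of_lt (by have := n.cast_nonneg (α := ℝ); linarith) hk
    exact_mod_cast this.le
  have hcont : Continuous fun ξ : E n => ((1 + ‖ξ‖) ^ (k - p) : ℝ)⁻¹ :=
    Continuous.inv₀ (by fun_prop) fun ξ => by positivity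
  -- The square of this weight is `(1 + ‖ξ‖)^(-2(k - p))`, integrable because `2(k - p) > n`;
  -- Cauchy–Schwarz then passes from `L²` to `L¹`.
  have hmem : MemLp (fun ξ : E n => ((1 + ‖ξ‖) ^ (k - p) : ℝ)⁻¹) 2 volume := by
    rw [memLp_two_iff_integrable_sq hcont.aestronglyMeasurable]
    have := integrable_one_add_norm (μ := (volume : Measure (E n))) (r := 2 * ((k : ℝ) - p))
      (by rw [finrank_euclideanSpace_fin]; linarith)
    refine this.congr (Eventually.of_forall fun ξ => ?_)
    have h1 : (0 : ℝ) ≤ 1 + ‖ξ‖ := by positivity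
    simp only
    rw [Real.rpow_neg h1, inv_pow, ← pow_mul, ← Real.rpow_natCast]
    push_cast [hpk]
    rw [mul_comm]
  refine ⟨(eLpNorm (fun ξ : E n => ((1 + ‖ξ‖) ^ (k - p) : ℝ)⁻¹) 2 volume).toNNReal * C,
    fun w => ?_⟩
  set F := 𝓕 (cut χ (w.1 (zeroIdx n k))) with hF
  have hFc : Continuous F := continuous_fourier (integrable_cut hχ _)
  have e : (fun ξ => ((1 + ‖ξ‖) ^ p : ℝ) • F ξ)
      = (fun ξ : E n => ((1 + ‖ξ‖) ^ (k - p) : ℝ)⁻¹) • fun ξ => ((1 + ‖ξ‖) ^ k : ℝ) • F ξ := by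
    funext ξ
    have h1 : (1 + ‖ξ‖) ≠ 0 := by positivity
    simp only [Pi.smul_apply', smul_smul]
    congr 1
    rw [← Nat.add_sub_cancel' hpk, pow_add, Nat.add_sub_cancel_left]
    field_simp
  refine (congrArg (fun G => eLpNorm G 1 volume) e).trans_le ?_
  refine (eLpNorm_smul_le_mul_eLpNorm (p := 2) (q := 2) (r := 1)
    (Continuous.aestronglyMeasurable (by fun_prop)) hcont.aestronglyMeasurable).trans ?_
  rw [ENNReal.coe_mul, ENNReal.coe_toNNReal hmem.2.ne, mul_assoc]
  gcongr
  exact hC w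

lemma continuous_cut {χ : E n → ℝ} (hχ : IsTest Ω χ) (hΩ : IsOpen Ω) {f : E n → ℝ}
    (hf : ContinuousOn f Ω) : Continuous fun x => χ x * f x :=
  (hχ.contDiff.continuous.continuousOn.mul hf).continuous_of_tsupport_subset hΩ
    ((tsupport_mul_subset_left (f := χ) (g := f)).trans hχ.subset)

/-- A continuous `H^k(Ω)` function, multiplied by a test function, is of class `C^p` if
`k > n/2 + p`, and its derivatives are bounded by the `H^k(Ω)` norm. -/
lemma exists_contDiff_mul_test (hΩ : IsOpen Ω) {k p : ℕ} (hk : (n : ℝ) / 2 + p < k)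
    {χ : E n → ℝ} (hχ : IsTest Ω χ) :
    ∃ C : ℝ≥0, ∀ (f : E n → ℝ) (w : SobolevSpace k Ω), ContinuousOn f Ω → Represents w f →
      ContDiff ℝ p (fun x => χ x * f x) ∧
      ∀ j ≤ p, ∀ x, ‖iteratedFDeriv ℝ j (fun x => χ x * f x) x‖ ≤ C * ‖w‖ := by
  obtain ⟨C, hC⟩ := exists_integral_weight_mul_fourier_le hΩ hk hχ
  refine ⟨(2 * NNReal.pi + 1) ^ p * C, fun f w hf hw => ?_⟩
  obtain ⟨h, hh⟩ : ∃ h : E n → ℂ, ∀ x, h x = ((χ x * f x : ℝ) : ℂ) := ⟨_, fun _ => rfl⟩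
  set F := 𝓕 (cut χ (w.1 (zeroIdx n k))) with hF
  have hFc : Continuous F := continuous_fourier (integrable_cut hχ _)
  have hae : cut χ (w.1 (zeroIdx n k)) =ᵐ[volume] h := by
    have := (ae_restrict_iff' hΩ.measurableSet).1 hw
    filter_upwards [this] with x hx
    by_cases hxΩ : x ∈ Ω
    · simp [cut, hh, hx hxΩ]
    · simp [cut, hh, hχ.eq_zero hxΩ]
  have hFh : 𝓕 h = F := by
    funext ξ; exact (Real.fourier_congr_ae hae ξ).symm
  have hhc : Continuous h := by
    rw [funext hh]
    exact Complex.continuous_ofReal.comp (continuous_cut hχ hΩ hf)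
  have hhi : Integrable h := (integrable_cut hχ _).congr hae
  have hwt := hC w
  have hW : Integrable (fun ξ => ((1 + ‖ξ‖) ^ p : ℝ) • F ξ) :=
    memLp_one_iff_integrable.1 ⟨Continuous.aestronglyMeasurable (by fun_prop),
      hwt.trans_lt (ENNReal.mul_lt_top ENNReal.coe_lt_top enorm_lt_top)⟩
  have hWb : ∫ ξ, ‖((1 + ‖ξ‖) ^ p : ℝ) • F ξ‖ ≤ C * ‖w‖ := by
    rw [eLpNorm_one_eq_lintegral_enorm, ← ofReal_integral_norm_eq_lintegral_enorm hW,
      ← ofReal_norm, ← ENNReal.ofReal_coe_nnreal, ← ENNReal.ofReal_mul C.coe_nonneg] at hwt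
    exact (ENNReal.ofReal_le_ofReal_iff (by positivity)).1 hwt
  have hle : ∀ j ≤ p, ∀ ξ : E n, ‖ξ‖ ^ j * ‖F ξ‖ ≤ ‖((1 + ‖ξ‖) ^ p : ℝ) • F ξ‖ := by
    intro j hj ξ
    rw [norm_smul, Real.norm_of_nonneg (by positivity)]
    gcongr
    calc ‖ξ‖ ^ j ≤ (1 + ‖ξ‖) ^ j := by gcongr; linarith
      _ ≤ (1 + ‖ξ‖) ^ p := pow_le_pow_right₀ (by linarith [norm_nonneg ξ]) hj
  have hmom : ∀ j : ℕ, j ≤ p → Integrable fun ξ : E n => ‖ξ‖ ^ j * ‖F ξ‖ := by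
    intro j hj
    refine hW.norm.mono' (Continuous.aestronglyMeasurable (by fun_prop))
      (Eventually.of_forall fun ξ => ?_)
    rw [Real.norm_of_nonneg (by positivity)]
    exact hle j hj ξ
  have hmom' : ∀ j : ℕ, (j : ℕ∞) ≤ (p : ℕ∞) → Integrable fun ξ : E n => ‖ξ‖ ^ j * ‖F ξ‖ :=
    fun j hj => hmom j (by exact_mod_cast hj)
  have hFi : Integrable F := by
    have := hmom 0 (Nat.zero_le _)
    simp only [pow_zero, one_mul] at this
    exact (integrable_norm_iff hFc.aestronglyMeasurable).1 this
  -- Fourier inversion holds at every point, not just almost everywhere, since `h` is continuous and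
  -- both `h` and `F` are integrable.
  have hinv : ∀ x, ((χ x * f x : ℝ) : ℂ) = 𝓕 F (-x) := by
    intro x
    have := congrFun (hhc.fourierInv_fourier_eq hhi (by rwa [hFh])) x
    rw [hFh, Real.fourierInv_eq_fourier_neg] at this
    rw [this, hh]
  suffices H : ∀ q : E n → ℝ, (∀ x, (q x : ℂ) = 𝓕 F (-x)) → ContDiff ℝ p q ∧
      ∀ j ≤ p, ∀ x, ‖iteratedFDeriv ℝ j q x‖ ≤ ((2 * NNReal.pi + 1) ^ p * C : ℝ≥0) * ‖w‖ from
    H _ hinv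
  intro q hq
  have hreal : q = Complex.reCLM ∘
      (𝓕 F ∘ (LinearIsometryEquiv.neg ℝ : E n ≃ₗᵢ[ℝ] E n)) := by
    funext x
    have := congrArg Complex.re (hq x)
    simpa using this
  have hcd : ContDiff ℝ p (𝓕 F) := by
    have := Real.contDiff_fourier (N := (p : ℕ∞)) hmom'
    exact_mod_cast this
  have hcd' : ContDiff ℝ p (𝓕 F ∘ (LinearIsometryEquiv.neg ℝ : E n ≃ₗᵢ[ℝ] E n)) :=
    hcd.comp (LinearIsometryEquiv.neg ℝ : E n ≃ₗᵢ[ℝ] E n).contDiff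
  refine ⟨by rw [hreal]; exact Complex.reCLM.contDiff.comp hcd', fun j hj x => ?_⟩
  rw [hreal]
  have hj' : (j : WithTop ℕ∞) ≤ (p : WithTop ℕ∞) := by exact_mod_cast hj
  rw [Complex.reCLM.iteratedFDeriv_comp_left hcd'.contDiffAt hj']
  refine (ContinuousLinearMap.norm_compContinuousMultilinearMap_le _ _).trans ?_
  rw [Complex.reCLM_norm, one_mul, LinearIsometryEquiv.norm_iteratedFDeriv_comp_right,
    Real.iteratedFDeriv_fourier (N := (p : ℕ∞)) hmom' hFc.aestronglyMeasurable
      (by exact_mod_cast hj)]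
  refine (VectorFourier.norm_fourierIntegral_le_integral_norm _ _ _ _ _).trans ?_
  have hπ : (0:ℝ) ≤ 2 * Real.pi := by positivity
  -- Each derivative costs a factor of at most `2π`; enlarging it to `2π + 1 ≥ 1` allows the
  -- exponent `j` to be raised to `p`.
  have hb : ∀ ξ : E n, ‖VectorFourier.fourierPowSMulRight (innerSL ℝ) F ξ j‖
      ≤ (2 * Real.pi + 1) ^ p * ‖((1 + ‖ξ‖) ^ p : ℝ) • F ξ‖ := by
    intro ξ
    refine (VectorFourier.norm_fourierPowSMulRight_le _ _ _ _).trans ?_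
    rw [mul_assoc]
    refine mul_le_mul ?_ (hle j hj ξ) (by positivity) (by positivity)
    have h1 : ‖(innerSL ℝ : E n →L[ℝ] _)‖ ≤ 1 := norm_innerSL_le ℝ
    calc (2 * Real.pi * ‖(innerSL ℝ : E n →L[ℝ] _)‖) ^ j ≤ (2 * Real.pi + 1) ^ j := by
          gcongr
          nlinarith
      _ ≤ _ := pow_le_pow_right₀ (by linarith) hj
  refine (integral_mono_of_nonneg (Eventually.of_forall fun _ => norm_nonneg _)
    (hW.norm.const_mul _) (Eventually.of_forall hb)).trans ?_
  rw [integral_const_mul]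
  push_cast
  rw [mul_assoc]
  refine mul_le_mul_of_nonneg_left hWb (by positivity)

end Sobolev

/-! ### Classical derivatives of continuous representatives -/

section MultiDeriv

variable {n : ℕ} {Ω : Set (E n)}

/-- The operator `T` is the evaluation of the `j`-th Fréchet derivative at fixed vectors of norm at
most `1`. -/
def IsDirDeriv (T : (E n → ℝ) → E n → ℝ) (j : ℕ) : Prop :=
  ∃ v : Fin j → E n, (∀ i, ‖v i‖ ≤ 1) ∧
    ∀ F : E n → ℝ, ContDiff ℝ j F → ∀ x, T F x = iteratedFDeriv ℝ j F x v

lemma IsDirDeriv.partialDeriv {T : (E n → ℝ) → E n → ℝ} {j : ℕ} (h : IsDirDeriv T j) (i : Fin n) :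
    IsDirDeriv (fun F => partialDeriv i (T F)) (j + 1) := by
  obtain ⟨v, hv, hT⟩ := h
  refine ⟨Fin.cons (EuclideanSpace.single i 1) v, fun i' => ?_, fun F hF x => ?_⟩
  · refine Fin.cases ?_ (fun i' => ?_) i'
    · simp
    · simpa using hv i'
  · have hd : DifferentiableAt ℝ (iteratedFDeriv ℝ j F) x :=
      (hF.differentiable_iteratedFDeriv (by exact_mod_cast Nat.lt_succ_self j)) x
    have e : T F = fun x => iteratedFDeriv ℝ j F x v :=
      funext (hT F (hF.of_le (by exact_mod_cast Nat.le_succ j)))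
    rw [iteratedFDeriv_succ_apply_left, Fin.cons_zero, Fin.tail_cons]
    change fderiv ℝ (T F) x _ = _
    rw [e]
    have := (hd.hasFDerivAt.continuousMultilinear_apply_const v).fderiv
    rw [this]
    rfl

/-- Transfers bounds and continuity from the Fréchet derivative to iterated partial derivatives;
each partial derivative adds one coordinate vector in front. -/
lemma isDirDeriv_multiDeriv (α : Fin n → ℕ) : IsDirDeriv (multiDeriv α) (∑ i, α i) := by
  rw [Fin.sum_univ_def]
  unfold multiDeriv
  induction List.finRange n with
  | nil =>
    refine ⟨![], fun i => i.elim0, fun F _ x => ?_⟩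
    exact (iteratedFDeriv_zero_apply _).symm
  | cons i l ih =>
    rw [List.map_cons, List.sum_cons, add_comm]
    simp only [List.foldr_cons]
    induction α i with
    | zero => exact ih
    | succ m ihm =>
      simp only [Function.iterate_succ_apply']
      exact ihm.partialDeriv i

/-- Derivatives are local, so near a point `f` may be replaced by `χ f` when `χ = 1` there. -/
lemma multiDeriv_congr (α : Fin n → ℕ) {f g : E n → ℝ} {x : E n} (h : f =ᶠ[𝓝 x] g) :
    multiDeriv α f =ᶠ[𝓝 x] multiDeriv α g := by
  unfold multiDeriv
  induction List.finRange n with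
  | nil => exact h
  | cons i l ih =>
    simp only [List.foldr_cons]
    induction α i with
    | zero => exact ih
    | succ m ihm =>
      simp only [Function.iterate_succ_apply']
      filter_upwards [ihm.fderiv (𝕜 := ℝ)] with y hy
      rw [partialDeriv, hy, partialDeriv]

lemma Represents.sub {k : ℕ} {w w' : SobolevSpace k Ω} {f g : E n → ℝ} (h : Represents w f)
    (h' : Represents w' g) : Represents (w - w') (fun x => f x - g x) := by
  have e : (w - w').1 (zeroIdx n k) = w.1 (zeroIdx n k) - w'.1 (zeroIdx n k) := rfl
  unfold Represents at *
  rw [e]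
  filter_upwards [Lp.coeFn_sub (w.1 (zeroIdx n k)) (w'.1 (zeroIdx n k)), h, h'] with x h1 h2 h3
  rw [h1, Pi.sub_apply, h2, h3]

/-- Interior Sobolev embedding `H^k → C^p`, `k > n/2 + p`, for the classical derivatives of
continuous representatives. -/
lemma exists_multiDeriv_sub_le (hΩ : IsOpen Ω) {k p : ℕ} (hk : (n : ℝ) / 2 + p < k) {x₀ : E n}
    (hx₀ : x₀ ∈ Ω) : ∃ U ∈ 𝓝 x₀, ∃ C : ℝ, ∀ (f g : E n → ℝ) (w w' : SobolevSpace k Ω),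
      ContinuousOn f Ω → ContinuousOn g Ω → Represents w f → Represents w' g →
      ∀ α ∈ multiIdx n p, ContinuousAt (multiDeriv α f) x₀ ∧
        ∀ x ∈ U, |multiDeriv α f x - multiDeriv α g x| ≤ C * ‖w - w'‖ := by
  obtain ⟨r, hr, hrΩ⟩ := Metric.isOpen_iff.1 hΩ x₀ hx₀
  -- Equal to `1` on the ball of radius `r / 4`, with support in the closed ball of radius `r / 2`,
  -- which lies in `Ω`.
  let χ : ContDiffBump x₀ := ⟨r / 4, r / 2, by linarith, by linarith⟩
  have hχ : IsTest Ω χ := ⟨χ.contDiff, χ.hasCompactSupport, by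
    rw [χ.tsupport_eq]
    exact (Metric.closedBall_subset_ball (by change r / 2 < r; linarith)).trans hrΩ⟩
  obtain ⟨C, hC⟩ := exists_contDiff_mul_test hΩ hk hχ
  have hr4 : 0 < r / 4 := by linarith
  have hloc : ∀ f : E n → ℝ, ∀ x ∈ Metric.ball x₀ (r / 4), f =ᶠ[𝓝 x] fun x => χ x * f x := by
    intro f x hx
    filter_upwards [Metric.isOpen_ball.mem_nhds hx] with y hy
    rw [χ.one_of_mem_closedBall (Metric.ball_subset_closedBall hy), one_mul]
  refine ⟨Metric.ball x₀ (r / 4), Metric.ball_mem_nhds _ hr4, C,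
    fun f g w w' hf hg hwf hwg α hα => ?_⟩
  have hα' : ∑ i, α i ≤ p := mem_multiIdx.1 hα
  have hle : ((∑ i, α i : ℕ) : WithTop ℕ∞) ≤ (p : WithTop ℕ∞) := by exact_mod_cast hα'
  obtain ⟨v, hv, hT⟩ := isDirDeriv_multiDeriv α
  have hF := ((hC f w hf hwf).1).of_le hle
  have hG := ((hC g w' hg hwg).1).of_le hle
  refine ⟨?_, fun x hx => ?_⟩
  · rw [continuousAt_congr (multiDeriv_congr α (hloc f x₀ (Metric.mem_ball_self hr4)))]
    have e : multiDeriv α (fun x => χ x * f x)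
        = fun x => iteratedFDeriv ℝ (∑ i, α i) (fun x => χ x * f x) x v := funext (hT _ hF)
    rw [e]
    exact ((hF.continuous_iteratedFDeriv le_rfl).eval_const v).continuousAt
  · rw [(multiDeriv_congr α (hloc f x hx)).eq_of_nhds, (multiDeriv_congr α (hloc g x hx)).eq_of_nhds,
      hT _ hF, hT _ hG]
    have hsub := iteratedFDeriv_sub_apply (x := x) hF.contDiffAt hG.contDiffAt
    have e : (fun x => χ x * f x) - (fun x => χ x * g x) = fun x => χ x * (f x - g x) := by
      funext y; simp [mul_sub]
    rw [← sub_apply, ← hsub, e, ← Real.norm_eq_abs]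
    refine (ContinuousMultilinearMap.le_opNorm _ _).trans ?_
    have hb := (hC _ _ (hf.sub hg) (hwf.sub hwg)).2 _ hα' x
    refine (mul_le_of_le_one_right (norm_nonneg _)
      (Finset.prod_le_one (fun i _ => norm_nonneg _) fun i _ => hv i)).trans hb

lemma continuousAt_multiDeriv (hΩ : IsOpen Ω) {k p : ℕ} (hk : (n : ℝ) / 2 + p < k)
    {f : E n → ℝ} {w : SobolevSpace k Ω} (hf : ContinuousOn f Ω) (hw : Represents w f)
    {α : Fin n → ℕ} (hα : α ∈ multiIdx n p) {x : E n} (hx : x ∈ Ω) :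
    ContinuousAt (multiDeriv α f) x := by
  obtain ⟨U, -, C, h⟩ := exists_multiDeriv_sub_le hΩ hk hx
  exact (h f f w w hf hf hw hw α hα).1

/-- Convergence in `H^k(Ω)` implies locally uniform convergence of the derivatives of order
less than `k - n/2`. -/
lemma tendsto_multiDeriv (hΩ : IsOpen Ω) {k p : ℕ} (hk : (n : ℝ) / 2 + p < k)
    {ι : Type*} {l : Filter ι} {f : ι → E n → ℝ} {w : ι → SobolevSpace k Ω}
    (hf : ∀ i, ContinuousOn (f i) Ω) (hw : ∀ i, Represents (w i) (f i))
    {g : E n → ℝ} {w' : SobolevSpace k Ω} (hg : ContinuousOn g Ω) (hw' : Represents w' g)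
    (hlim : Tendsto w l (𝓝 w')) {α : Fin n → ℕ} (hα : α ∈ multiIdx n p)
    {y : ι → E n} {x : E n} (hx : x ∈ Ω) (hy : Tendsto y l (𝓝 x)) :
    Tendsto (fun i => multiDeriv α (f i) (y i)) l (𝓝 (multiDeriv α g x)) := by
  obtain ⟨U, hU, C, h⟩ := exists_multiDeriv_sub_le hΩ hk hx
  have h1 : Tendsto (fun i => multiDeriv α g (y i)) l (𝓝 (multiDeriv α g x)) :=
    (continuousAt_multiDeriv hΩ hk hg hw' hα hx).tendsto.comp hy
  have h2 : Tendsto (fun i => multiDeriv α (f i) (y i) - multiDeriv α g (y i)) l (𝓝 0) := by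
    have h3 : Tendsto (fun i => C * ‖w i - w'‖) l (𝓝 0) := by
      simpa using (tendsto_iff_norm_sub_tendsto_zero.1 hlim).const_mul C
    refine squeeze_zero_norm' ?_ h3
    filter_upwards [hy hU] with i hi
    exact (h (f i) g (w i) w' (hf i) hg (hw i) hw' α hα).2 _ hi
  simpa using h2.add h1

end MultiDeriv

/-! ### Weak convergence in Hilbert spaces -/

section Weak

variable {H : Type*} [NormedAddCommGroup H] [InnerProductSpace ℝ H] {ι : Type*}

/-- Weak convergence in a real inner product space. -/
def WeakTendsto (x : ι → H) (l : Filter ι) (a : H) : Prop :=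
  ∀ y : H, Tendsto (fun i => inner ℝ y (x i)) l (𝓝 (inner ℝ y a))

lemma WeakTendsto.mono {x : ι → H} {l l' : Filter ι} {a : H} (h : WeakTendsto x l a)
    (hl : l' ≤ l) : WeakTendsto x l' a := fun y => (h y).mono_left hl

/-- Weak compactness of balls: each inner product lies in a compact interval and so has a limit
along `𝒰`. The limit is linear and bounded in `y`, and Riesz represents it. -/
lemma exists_weakTendsto_ultrafilter [CompleteSpace H] (𝒰 : Ultrafilter ι) {x : ι → H} {R : ℝ}
    (hx : ∀ i, ‖x i‖ ≤ R) : ∃ a, WeakTendsto x 𝒰 a := by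
  have hc : ∀ y : H, ∃ c : ℝ, Tendsto (fun i => inner ℝ y (x i)) 𝒰 (𝓝 c) := by
    intro y
    have hK := isCompact_closedBall (0 : ℝ) (‖y‖ * R)
    obtain ⟨c, -, hc⟩ := hK.ultrafilter_le_nhds (𝒰.map fun i => inner ℝ y (x i)) (by
      rw [le_principal_iff]
      refine Filter.mem_map.2 (Filter.univ_mem' fun i => ?_)
      simp only [Set.mem_preimage, mem_closedBall_zero_iff]
      exact (norm_inner_le_norm _ _).trans (by gcongr; exact hx i))
    exact ⟨c, hc⟩
  choose c hc using hc
  let φ : H →ₗ[ℝ] ℝ :=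
    { toFun := c
      map_add' := fun y z => tendsto_nhds_unique (hc (y + z)) (by
        simpa only [inner_add_left] using (hc y).add (hc z))
      map_smul' := fun r y => tendsto_nhds_unique (hc (r • y)) (by
        simpa only [inner_smul_left, RingHom.id_apply, smul_eq_mul, conj_trivial]
          using (hc y).const_mul r) }
  have hφ : ∀ y, ‖φ y‖ ≤ R * ‖y‖ := fun y =>
    le_of_tendsto (hc y).norm (Eventually.of_forall fun i => by
      rw [mul_comm]
      exact (norm_inner_le_norm _ _).trans (by gcongr; exact hx i))
  refine ⟨(InnerProductSpace.toDual ℝ H).symm (φ.mkContinuous R hφ), fun y => ?_⟩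
  rw [real_inner_comm, InnerProductSpace.toDual_symm_apply]
  exact hc y

/-- A compact operator maps bounded weakly convergent families to convergent ones. -/
lemma WeakTendsto.compact [CompleteSpace H] {F : Type*} [NormedAddCommGroup F] [NormedSpace ℝ F]
    {T : H →L[ℝ] F} (hT : IsCompactOperator T) {x : ι → H} {l : Filter ι} {a : H}
    (h : WeakTendsto x l a) {R : ℝ} (hx : ∀ i, ‖x i‖ ≤ R) :
    Tendsto (fun i => T (x i)) l (𝓝 (T a)) := by
  rw [tendsto_iff_ultrafilter]
  intro 𝒰 h𝒰
  have hK := hT.isCompact_closure_image_closedBall R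
  obtain ⟨z, -, hz⟩ := hK.ultrafilter_le_nhds (𝒰.map fun i => T (x i)) (by
    rw [le_principal_iff]
    refine Filter.mem_map.2 (Filter.univ_mem' fun i => subset_closure ⟨x i, ?_, rfl⟩)
    simpa using hx i)
  have hz' : Tendsto (fun i => T (x i)) 𝒰 (𝓝 z) := hz
  -- Compactness supplies the limit `z`; continuous functionals composed with `T` see weak
  -- convergence, and they separate points.
  have : z = T a := by
    refine (SeparatingDual.eq_iff_forall_dual_eq (R := ℝ)).2 fun ψ => ?_
    have h1 : Tendsto (fun i => ψ (T (x i))) 𝒰 (𝓝 (ψ z)) := (ψ.continuous.tendsto z).comp hz'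
    have h2 := (h.mono h𝒰) ((InnerProductSpace.toDual ℝ H).symm (ψ.comp T))
    simp only [InnerProductSpace.toDual_symm_apply] at h2
    exact tendsto_nhds_unique h1 h2
  rwa [this] at hz'

end Weak

/-! ### Reproducing kernel Hilbert spaces -/

section RKHS

variable {X : Type*} {H : Type*} [NormedAddCommGroup H] [InnerProductSpace ℝ H] [CompleteSpace H]
  [RKHS ℝ H X ℝ]

variable (H) in
/-- The representer `K(x, ·)` of the evaluation at `x`. -/
noncomputable def kerVec (x : X) : H := RKHS.kerFun H x 1

@[simp] lemma inner_kerVec (x : X) (f : H) : inner ℝ (kerVec H x) f = f x := by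
  rw [kerVec, RKHS.kerFun_inner]
  simp

lemma kerVec_apply (x y : X) : (kerVec H y) x = rkhsKernel H x y := by
  rw [kerVec, RKHS.kerFun_apply, rkhsKernel]

lemma inner_kerVec_kerVec (x y : X) : inner ℝ (kerVec H x) (kerVec H y) = rkhsKernel H x y := by
  rw [inner_kerVec, kerVec_apply]

/-- `‖K_x - K_y‖² = K(x,x) - 2K(x,y) + K(y,y)`. -/
lemma continuous_kerVec [TopologicalSpace X]
    (hK : Continuous fun y : X × X => rkhsKernel H y.1 y.2) :
    Continuous (kerVec H : X → H) := by
  rw [continuous_iff_continuousAt]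
  intro y
  rw [ContinuousAt, tendsto_iff_norm_sub_tendsto_zero]
  have h1 : Continuous fun x : X => rkhsKernel H x x - 2 * rkhsKernel H x y + rkhsKernel H y y :=
    ((hK.comp (continuous_id.prodMk continuous_id)).sub
      (continuous_const.mul (hK.comp (continuous_id.prodMk continuous_const)))).add
      continuous_const
  have h2 : ∀ x : X, ‖kerVec H x - kerVec H y‖
      = √(rkhsKernel H x x - 2 * rkhsKernel H x y + rkhsKernel H y y) := by
    intro x
    rw [← inner_kerVec_kerVec, ← inner_kerVec_kerVec, ← inner_kerVec_kerVec,
      real_inner_self_eq_norm_sq, real_inner_self_eq_norm_sq, ← norm_sub_sq_real,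
      Real.sqrt_sq (norm_nonneg _)]
  simp only [h2]
  have h3 := (Real.continuous_sqrt.comp h1).tendsto y
  have e : rkhsKernel H y y - 2 * rkhsKernel H y y + rkhsKernel H y y = 0 := by ring
  simpa [Function.comp_def, e] using h3

lemma continuous_of_continuous_kernel [TopologicalSpace X]
    (hK : Continuous fun y : X × X => rkhsKernel H y.1 y.2) (v : H) : Continuous (v : X → ℝ) := by
  have : (v : X → ℝ) = fun x => inner ℝ (kerVec H x) v := by funext x; simp
  rw [this]
  exact (continuous_kerVec hK).inner continuous_const

lemma WeakTendsto.apply {ι : Type*} {l : Filter ι} {f : ι → H} {a : H} (h : WeakTendsto f l a)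
    (x : X) : Tendsto (fun i => f i x) l (𝓝 (a x)) := by
  simpa using h (kerVec H x)

/-- A bounded pointwise convergent family in an RKHS converges weakly. -/
lemma weakTendsto_of_pointwise {ι : Type*} {l : Filter ι} {f : ι → H} {a : H} {R : ℝ}
    (hf : ∀ i, ‖f i‖ ≤ R) (h : ∀ x, Tendsto (fun i => f i x) l (𝓝 (a x))) :
    WeakTendsto f l a := by
  intro y
  rw [tendsto_iff_ultrafilter]
  intro 𝒰 h𝒰
  obtain ⟨b, hb⟩ := exists_weakTendsto_ultrafilter 𝒰 hf
  have : b = a := RKHS.ext fun x => tendsto_nhds_unique (hb.apply x) ((h x).mono_left h𝒰)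
  exact this ▸ hb y

lemma mem_orthogonal_span_kerVec {S : Set X} {f : H} (h : ∀ s ∈ S, f s = 0) :
    f ∈ (Submodule.span ℝ (kerVec H '' S)).topologicalClosureᗮ := by
  rw [Submodule.orthogonal_closure, Submodule.mem_orthogonal]
  intro u hu
  induction hu using Submodule.span_induction with
  | mem u hu =>
    obtain ⟨s, hs, rfl⟩ := hu
    rw [inner_kerVec, h s hs]
  | zero => simp
  | add u v _ _ hu hv => rw [inner_add_left, hu, hv, add_zero]
  | smul c u _ hu => rw [inner_smul_left, hu, mul_zero]

/-- Evaluation at `s` is the inner product with `K_s`, and the self-adjoint projection fixes `K_s`.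
-/
lemma starProjection_span_kerVec_apply {S : Set X} {V : Submodule ℝ H}
    [V.HasOrthogonalProjection] (hV : ∀ s ∈ S, kerVec H s ∈ V) (f : H) {s : X} (hs : s ∈ S) :
    V.starProjection f s = f s := by
  rw [← inner_kerVec, ← inner_kerVec, ← Submodule.inner_starProjection_left_eq_right,
    Submodule.starProjection_eq_self_iff.2 (hV s hs)]

/-- If the kernel has a feature map `φ` into a Hilbert space, every function `x ↦ ⟨b, φ x⟩` is in
the RKHS. -/
lemma exists_eq_inner_feature {F : Type*} [NormedAddCommGroup F] [InnerProductSpace ℝ F]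
    {φ : X → F} (hφ : ∀ x y, inner ℝ (φ x) (φ y) = rkhsKernel H x y) (b : F) :
    ∃ v : H, ∀ x, v x = inner ℝ b (φ x) := by
  let S : (X →₀ ℝ) →ₗ[ℝ] H := Finsupp.linearCombination ℝ (kerVec H)
  let T : (X →₀ ℝ) →ₗ[ℝ] F := Finsupp.linearCombination ℝ φ
  let ℓ : (X →₀ ℝ) →ₗ[ℝ] ℝ := (innerₗ F b).comp T
  -- Equal kernels make the two spans isometric, so `ℓ` is bounded by the norm of `S a`; it extends
  -- from the dense range of `S` to `H`, where Riesz gives `v`.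
  have hnorm : ∀ a, ‖T a‖ = ‖S a‖ := by
    intro a
    have : inner ℝ (T a) (T a) = inner ℝ (S a) (S a) := by
      simp only [S, T, Finsupp.linearCombination_apply, Finsupp.sum, sum_inner, inner_sum,
        inner_smul_left, inner_smul_right, hφ, inner_kerVec_kerVec]
    rw [real_inner_self_eq_norm_sq, real_inner_self_eq_norm_sq] at this
    exact (pow_left_inj₀ (norm_nonneg _) (norm_nonneg _) two_ne_zero).1 this
  have hbd : ∃ C, ∀ a, ‖ℓ a‖ ≤ C * ‖S a‖ := ⟨‖b‖, fun a => by
    rw [← hnorm]; exact norm_inner_le_norm _ _⟩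
  have hdense : DenseRange S := by
    have h1 : (LinearMap.range S).topologicalClosure = ⊤ := by
      rw [Finsupp.range_linearCombination, ← Submodule.orthogonal_eq_bot_iff,
        Submodule.eq_bot_iff]
      intro f hf
      refine RKHS.ext fun x => ?_
      rw [← inner_kerVec, RKHS.coe_zero, Pi.zero_apply]
      exact (Submodule.mem_orthogonal _ _).1 hf _
        (Submodule.le_topologicalClosure _ (Submodule.subset_span ⟨x, rfl⟩))
    exact (Submodule.dense_iff_topologicalClosure_eq_top.2 h1)
  refine ⟨(InnerProductSpace.toDual ℝ H).symm (ℓ.extendOfNorm S), fun x => ?_⟩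
  rw [← inner_kerVec, real_inner_comm, InnerProductSpace.toDual_symm_apply]
  have := LinearMap.extendOfNorm_eq hdense hbd (Finsupp.single x 1)
  simpa [S, T, ℓ] using this

/-- The feature map is `x ↦ (√λᵢ eᵢ(x))ᵢ` in `ℓ²`, and `b = (cᵢ/√λᵢ)ᵢ` lies in `ℓ²` because `cᵢ²/λᵢ
≤ λ₀ λᵢ⁻² cᵢ²`. Where `λᵢ = 0`, `cᵢ = 0` and the quotient is `0`. -/
lemma exists_eq_of_mem_powerSpace {n : ℕ} {Ω : Set (E n)} {H : Type*} [NormedAddCommGroup H]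
    [InnerProductSpace ℝ H] [CompleteSpace H] [RKHS ℝ H Ω ℝ] {u : Ω → ℝ}
    (hu : u ∈ powerSpace (rkhsKernel H) 2) : ∃ v : H, (v : Ω → ℝ) = u := by
  obtain ⟨lam, e, hM, c, hc0, hc, hsum⟩ := hu
  have h2 : ∀ i, √(lam i) ^ 2 = lam i := fun i => Real.sq_sqrt (hM.nonneg i)
  let φ : Ω → lp (fun _ : ℕ => ℝ) 2 := fun x => ⟨fun i => √(lam i) * e i x, by
    refine memℓp_gen ?_
    have := (hM.hasSum x x).summable
    refine this.congr fun i => ?_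
    have := h2 i
    simp only [ENNReal.toReal_ofNat, Real.rpow_ofNat, Real.norm_eq_abs, sq_abs, mul_pow, h2]
    ring⟩
  let b : lp (fun _ : ℕ => ℝ) 2 := ⟨fun i => c i / √(lam i), by
    refine memℓp_gen ?_
    refine Summable.of_nonneg_of_le (fun i => by positivity) (fun i => ?_) (hc.mul_left (lam 0))
    simp only [ENNReal.toReal_ofNat, Real.rpow_ofNat, Real.norm_eq_abs, sq_abs, div_pow, h2]
    by_cases h0 : lam i = 0
    · simp [hc0 i h0]
    · have hpos : 0 < lam i := lt_of_le_of_ne (hM.nonneg i) (Ne.symm h0)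
      rw [Real.rpow_neg hpos.le, Real.rpow_ofNat]
      have hle : lam i ≤ lam 0 := hM.antitone (Nat.zero_le i)
      calc c i ^ 2 / lam i = lam i * ((lam i ^ 2)⁻¹ * c i ^ 2) := by field_simp
        _ ≤ lam 0 * ((lam i ^ 2)⁻¹ * c i ^ 2) := by gcongr⟩
  have hφ : ∀ x y, inner ℝ (φ x) (φ y) = rkhsKernel H x y := by
    intro x y
    have h1 := lp.hasSum_inner (𝕜 := ℝ) (φ x) (φ y)
    have e1 : (fun i => inner ℝ (φ x i) (φ y i)) = fun i => lam i * e i x * e i y := by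
      funext i
      change √(lam i) * e i y * (√(lam i) * e i x) = _
      linear_combination (e i x * e i y) * h2 i
    rw [e1] at h1
    exact h1.unique (hM.hasSum x y)
  obtain ⟨v, hv⟩ := exists_eq_inner_feature hφ b
  refine ⟨v, funext fun x => ?_⟩
  rw [hv]
  have h1 := lp.hasSum_inner (𝕜 := ℝ) b (φ x)
  have e1 : (fun i => inner ℝ (b i) (φ x i)) = fun i => c i * e i x := by
    funext i
    change √(lam i) * e i x * (c i / √(lam i)) = _
    by_cases h0 : lam i = 0
    · simp [hc0 i h0]
    · have : √(lam i) ≠ 0 := by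
        rw [Real.sqrt_ne_zero (hM.nonneg i)]; exact h0
      field_simp
  rw [e1] at h1
  exact h1.unique (hsum x)

end RKHS

/-! ### Restriction of Sobolev functions -/

section Restriction

variable {n : ℕ} {Ω Ω' : Set (E n)}

lemma setIntegral_mul_test_eq (hsub : Ω' ⊆ Ω) (hΩ : IsOpen Ω) {ψ : E n → ℝ}
    (hψ : ∀ x ∉ Ω', ψ x = 0) (f : E n → ℝ) :
    ∫ x in Ω, f x * ψ x = ∫ x in Ω', f x * ψ x :=
  setIntegral_eq_of_subset_of_forall_sdiff_eq_zero hΩ.measurableSet hsub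
    fun x hx => by rw [hψ x hx.2, mul_zero]

lemma isTest_multiDeriv {φ : E n → ℝ} (hφ : IsTest Ω φ) (α : Fin n → ℕ) :
    IsTest Ω (multiDeriv α φ) := by
  unfold multiDeriv
  induction List.finRange n with
  | nil => exact hφ
  | cons i l ih =>
    simp only [List.foldr_cons]
    induction α i with
    | zero => exact ih
    | succ m ihm =>
      simp only [Function.iterate_succ_apply']
      exact ihm.partialDeriv i

lemma IsTest.mono {φ : E n → ℝ} (hφ : IsTest Ω' φ) (h : Ω' ⊆ Ω) : IsTest Ω φ :=
  ⟨hφ.contDiff, hφ.compact, hφ.subset.trans h⟩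

/-- Restriction to a smaller set and truncation to a lower order of a Sobolev function. -/
lemma exists_sobolev_restrict {k k' : ℕ} (hk : k' ≤ k) (hΩ : IsOpen Ω) (hsub : Ω' ⊆ Ω)
    (w : SobolevSpace k Ω) : ∃ w' : SobolevSpace k' Ω', ‖w'‖ ≤ ‖w‖ ∧
      ∀ f, Represents w f → Represents w' f := by
  have hμ : (volume : Measure (E n)).restrict Ω' ≤ volume.restrict Ω :=
    Measure.restrict_mono hsub le_rfl
  let j : multiIdx n k' ↪ multiIdx n k :=
    ⟨fun α => ⟨α.1, mem_multiIdx.2 ((mem_multiIdx.1 α.2).trans hk)⟩,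
      fun α β h => Subtype.ext (congrArg (fun γ : multiIdx n k => γ.1) h)⟩
  have hm : ∀ α, MemLp (w.1 α) 2 (volume.restrict Ω') := fun α => (Lp.memLp (w.1 α)).mono_measure hμ
  let W : PiLp 2 fun _ : multiIdx n k' => Lp ℝ 2 (volume.restrict Ω') :=
    WithLp.toLp 2 fun α => (hm (j α)).toLp _
  have hW : ∀ α, W α =ᵐ[volume.restrict Ω'] w.1 (j α) := fun α => (hm (j α)).coeFn_toLp
  have hint : ∀ α (ψ : E n → ℝ), IsTest Ω' ψ →
      ∫ x in Ω', W α x * ψ x = ∫ x in Ω, w.1 (j α) x * ψ x := by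
    intro α ψ hψ
    rw [setIntegral_mul_test_eq hsub hΩ (fun x hx => hψ.eq_zero hx)]
    refine integral_congr_ae ?_
    filter_upwards [hW α] with x hx
    rw [hx]
  have hmem : W ∈ SobolevSpace k' Ω' := by
    intro α φ hφ
    rw [hint _ _ (isTest_multiDeriv hφ α.1), hint _ _ hφ]
    exact w.2 (j α) φ (hφ.mono hsub)
  refine ⟨⟨W, hmem⟩, ?_, fun f hf => ?_⟩
  · have h1 : ‖W‖ ^ 2 ≤ ‖w.1‖ ^ 2 := by
      rw [PiLp.norm_sq_eq_of_L2, PiLp.norm_sq_eq_of_L2]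
      calc ∑ α, ‖W α‖ ^ 2 ≤ ∑ α, ‖w.1 (j α)‖ ^ 2 := by
            refine Finset.sum_le_sum fun α _ => ?_
            gcongr
            rw [Lp.norm_def, Lp.norm_def]
            refine ENNReal.toReal_mono (Lp.eLpNorm_ne_top _) ?_
            rw [eLpNorm_congr_ae (hW α)]
            exact eLpNorm_mono_measure _ hμ
        _ = ∑ β ∈ Finset.univ.map j, ‖w.1 β‖ ^ 2 :=
            (Finset.sum_map Finset.univ j fun β => ‖w.1 β‖ ^ 2).symm
        _ ≤ _ := Finset.sum_le_sum_of_subset_of_nonneg (Finset.subset_univ _)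
          fun _ _ _ => by positivity
    exact (pow_le_pow_iff_left₀ (norm_nonneg _) (norm_nonneg _) two_ne_zero).1 h1
  · exact (hW (zeroIdx n k')).trans (ae_mono hμ hf)

lemma sobolevENorm_le_of_represents {k k' : ℕ} (hk : k' ≤ k) (hΩ : IsOpen Ω) (hsub : Ω' ⊆ Ω)
    {w : SobolevSpace k Ω} {f : E n → ℝ} (hw : Represents w f) :
    sobolevENorm k' Ω' f ≤ ‖w‖ₑ := by
  obtain ⟨w', hn, h⟩ := exists_sobolev_restrict hk hΩ hsub w
  exact (iInf₂_le w' (h f hw)).trans (enorm_le_iff_norm_le.2 hn)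

lemma sobolevENorm_congr {k : ℕ} (hΩ : MeasurableSet Ω) {f g : E n → ℝ} (h : ∀ x ∈ Ω, f x = g x) :
    sobolevENorm k Ω f = sobolevENorm k Ω g := by
  have : f =ᵐ[volume.restrict Ω] g := (ae_restrict_iff' hΩ).2 (Eventually.of_forall h)
  refine iInf_congr fun w => iInf_congr_Prop ⟨fun h' => h'.trans this, fun h' => h'.trans this.symm⟩
    fun _ => rfl

/-- Convergence in a Hilbert space embedded in `H^k(Ω)` implies convergence in `H^{k'}(Ω')`. -/
lemma tendsto_sobolevENorm {V : Type*} [NormedAddCommGroup V] [NormedSpace ℝ V] {k k' : ℕ}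
    (hk : k' ≤ k) (hΩ : IsOpen Ω) (hsub : Ω' ⊆ Ω) {F : V → E n → ℝ}
    {T : V → SobolevSpace k Ω} (hT : ∀ v, Represents (T v) (F v)) {ι : Type*} {l : Filter ι}
    {v : ι → V} {a : V} (h : Tendsto (fun i => T (v i)) l (𝓝 (T a))) :
    Tendsto (fun i => sobolevENorm k' Ω' fun x => F (v i) x - F a x) l (𝓝 0) := by
  have h1 : Tendsto (fun i => ‖T (v i) - T a‖ₑ) l (𝓝 0) := by
    have := (tendsto_iff_norm_sub_tendsto_zero.1 h)
    have h2 := (ENNReal.continuous_ofReal.tendsto 0).comp this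
    simpa only [Function.comp_def, ofReal_norm, ENNReal.ofReal_zero] using h2
  refine tendsto_of_tendsto_of_tendsto_of_le_of_le tendsto_const_nhds h1 (fun _ => zero_le)
    fun i => sobolevENorm_le_of_represents hk hΩ hsub ((hT (v i)).sub (hT a))

end Restriction

/-! ### Functions on a subset, and the map `Φ` -/

section Phi

variable {d p Q : ℕ} {𝓨 : Set (E d)}

lemma ext0_apply (v : 𝓨 → ℝ) (y : 𝓨) : ext0 v y = v y :=
  Subtype.val_injective.extend_apply v 0 y

lemma continuousOn_ext0 {v : 𝓨 → ℝ} (hv : Continuous v) : ContinuousOn (ext0 v) 𝓨 := by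
  rw [continuousOn_iff_continuous_domRestrict]
  have : 𝓨.domRestrict (ext0 v) = v := funext fun y => ext0_apply v y
  rwa [this]

lemma ext0_sub (v v' : 𝓨 → ℝ) :
    ext0 (fun y => v y - v' y) = fun x => ext0 v x - ext0 v' x := by
  funext x
  by_cases hx : x ∈ 𝓨
  · rw [ext0_apply (fun y => v y - v' y) ⟨x, hx⟩, ext0_apply v ⟨x, hx⟩, ext0_apply v' ⟨x, hx⟩]
  · have hx' : ¬ ∃ y : 𝓨, (y : E d) = x := fun ⟨y, hy⟩ => hx (hy ▸ y.2)
    simp [ext0, Function.extend_apply' _ _ _ hx']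

/-- Function and point vary together: the coefficients are continuous and `γ > d/2 + p` makes the
derivatives of order at most `p` converge locally uniformly. -/
lemma tendsto_Phi (h𝓨 : IsOpen 𝓨) {γ : ℕ} (hγ : (d : ℝ) / 2 + p < γ) (L : Fin Q → DiffOp 𝓨 p)
    {ι : Type*} {l : Filter ι} {v : ι → 𝓨 → ℝ} {w : ι → SobolevSpace γ 𝓨}
    (hv : ∀ i, Continuous (v i)) (hw : ∀ i, Represents (w i) (ext0 (v i)))
    {v' : 𝓨 → ℝ} {w' : SobolevSpace γ 𝓨} (hv' : Continuous v') (hw' : Represents w' (ext0 v'))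
    (hlim : Tendsto w l (𝓝 w')) {y : ι → 𝓨} {x : 𝓨} (hy : Tendsto y l (𝓝 x)) :
    Tendsto (fun i => Phi L (v i) (y i)) l (𝓝 (Phi L v' x)) := by
  have hyv : Tendsto (fun i => (y i : E d)) l (𝓝 (x : E d)) :=
    (continuous_subtype_val.tendsto x).comp hy
  refine ((PiLp.continuous_toLp 2 _).tendsto _).comp (tendsto_pi_nhds.2 fun c => ?_)
  refine Fin.addCases (fun c => ?_) (fun q => ?_) c
  · simp only [Fin.append_left]
    exact (((EuclideanSpace.proj c : E d →L[ℝ] ℝ).continuous).tendsto _).comp hyv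
  · simp only [Fin.append_right, DiffOp.eval]
    refine tendsto_finsetSum _ fun α _ => ?_
    exact ((((L q).continuous_coeff α).tendsto x).comp hy).mul
      (tendsto_multiDeriv h𝓨 hγ (fun i => continuousOn_ext0 (hv i)) hw (continuousOn_ext0 hv') hw'
        hlim α.2 x.2 hyv)

lemma multiDeriv_zero {n : ℕ} (f : E n → ℝ) : multiDeriv 0 f = f := by
  simp [multiDeriv]

end Phi

/-! ### Interpolation on sets that become dense -/

section Interpolation

variable {d : ℕ} {𝓨 : Set (E d)}

lemma exists_tendsto_of_fillDistance {Y : ℕ → Finset 𝓨}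
    (h : Tendsto (fun N => fillDistance 𝓨 (Subtype.val '' (Y N : Set 𝓨))) atTop (𝓝 0)) (y : 𝓨) :
    ∃ z : ℕ → 𝓨, Tendsto z atTop (𝓝 y) ∧ ∀ᶠ N in atTop, z N ∈ Y N := by
  have h1 : Tendsto (fun N => Metric.infEDist (y : E d) (Subtype.val '' (Y N : Set 𝓨))) atTop
      (𝓝 0) :=
    tendsto_of_tendsto_of_tendsto_of_le_of_le tendsto_const_nhds h (fun _ => zero_le)
      fun N => le_iSup₂ (f := fun (y : E d) (_ : y ∈ 𝓨) =>
        Metric.infEDist y (Subtype.val '' (Y N : Set 𝓨))) (y : E d) y.2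
  have h2 : ∀ N, ∃ z : 𝓨, (Y N).Nonempty → z ∈ Y N ∧
      edist y z ≤ Metric.infEDist (y : E d) (Subtype.val '' (Y N : Set 𝓨)) := by
    intro N
    by_cases hN : (Y N).Nonempty
    · obtain ⟨z, hz, hmin⟩ := Finset.exists_min_image (Y N) (fun z => edist y z) hN
      refine ⟨z, fun _ => ⟨hz, ?_⟩⟩
      rw [Metric.le_infEDist]
      rintro _ ⟨x, hx, rfl⟩
      exact hmin x hx
    · exact ⟨y, fun h => absurd h hN⟩
  choose z hz using h2
  have hne : ∀ᶠ N in atTop, (Y N).Nonempty := by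
    filter_upwards [h1 (gt_mem_nhds (zero_lt_one' ℝ≥0∞))] with N hN
    by_contra hemp
    rw [Finset.not_nonempty_iff_eq_empty] at hemp
    simp [hemp] at hN
  refine ⟨z, ?_, hne.mono fun N hN => (hz N hN).1⟩
  rw [tendsto_iff_edist_tendsto_0]
  refine tendsto_of_tendsto_of_tendsto_of_le_of_le' tendsto_const_nhds h1
    (Eventually.of_forall fun _ => zero_le) (hne.mono fun N hN => ?_)
  rw [edist_comm]
  exact (hz N hN).2

/-- Bounded interpolants of an element of an RKHS with continuous kernel converge pointwise when
the interpolation points become dense. -/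
lemma tendsto_apply_of_interpolation {H : Type*} [NormedAddCommGroup H] [InnerProductSpace ℝ H]
    [CompleteSpace H] [RKHS ℝ H 𝓨 ℝ]
    (hK : Continuous fun y : 𝓨 × 𝓨 => rkhsKernel H y.1 y.2) {Y : ℕ → Finset 𝓨}
    (hY : Tendsto (fun N => fillDistance 𝓨 (Subtype.val '' (Y N : Set 𝓨))) atTop (𝓝 0))
    {v : ℕ → H} {a : H} {R : ℝ} (hR : ∀ N, ‖v N‖ ≤ R) (hv : ∀ N, ∀ y ∈ Y N, v N y = a y) (y : 𝓨) :
    Tendsto (fun N => v N y) atTop (𝓝 (a y)) := by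
  obtain ⟨z, hz, hzY⟩ := exists_tendsto_of_fillDistance hY y
  have h1 : Tendsto (fun N => a (z N)) atTop (𝓝 (a y)) :=
    ((continuous_of_continuous_kernel hK a).tendsto y).comp hz
  have h2 : Tendsto (fun N => v N y - a (z N)) atTop (𝓝 0) := by
    -- As `a (z N) = v N (z N)`, the error is the inner product of `v N` with a difference of
    -- representers.
    have h3 : Tendsto (fun N => ‖kerVec H (z N) - kerVec H y‖ * R) atTop (𝓝 0) := by
      simpa using (tendsto_iff_norm_sub_tendsto_zero.1
        (((continuous_kerVec hK).tendsto y).comp hz)).mul_const R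
    refine squeeze_zero_norm' ?_ h3
    filter_upwards [hzY] with N hN
    rw [← hv N _ hN, ← inner_kerVec, ← inner_kerVec, ← inner_sub_left, norm_sub_rev]
    exact (norm_inner_le_norm _ _).trans (by gcongr; exact hR N)
  simpa using h2.add h1

end Interpolation

/-! ### Convergence of minimizers -/

section Optimization

variable {H G : Type*} [NormedAddCommGroup H] [InnerProductSpace ℝ H] [NormedAddCommGroup G]
  [InnerProductSpace ℝ G]

/-- Strong convergence from an upper bound for the norms and the identification of the weak
limits. -/
lemma tendsto_of_norm_sq_add_le [CompleteSpace G] {ι κ : Type*} [Fintype κ] {l : Filter ι}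
    {x : ι → κ → H} {a : κ → H} {z : ι → G} {b : G}
    (hle : ∀ i, ‖z i‖ ^ 2 + ∑ m, ‖x i m‖ ^ 2 ≤ ‖b‖ ^ 2 + ∑ m, ‖a m‖ ^ 2)
    (hx : ∀ m, WeakTendsto (fun i => x i m) l (a m)) {R : ℝ} (hz : ∀ i, ‖z i‖ ≤ R)
    (hlim : ∀ 𝒰 : Ultrafilter ι, ↑𝒰 ≤ l → ∀ c, WeakTendsto z 𝒰 c → inner ℝ b c = ‖b‖ ^ 2) :
    Tendsto z l (𝓝 b) := by
  rw [tendsto_iff_ultrafilter]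
  intro 𝒰 h𝒰
  obtain ⟨c, hc⟩ := exists_weakTendsto_ultrafilter 𝒰 hz
  have hbc := hlim 𝒰 h𝒰 c hc
  -- Expand the square, bound `‖z i‖²` by `hle`, and use `‖x‖² ≥ 2⟨a, x⟩ - ‖a‖²` for each state:
  -- what remains is affine in `z` and `x`, hence controlled by weak limits.
  have h1 : ∀ i, ‖z i - b‖ ^ 2 ≤ 2 * (‖b‖ ^ 2 - inner ℝ b (z i))
      + ∑ m, 2 * (‖a m‖ ^ 2 - inner ℝ (a m) (x i m)) := by
    intro i
    have h2 : ∑ m, (‖a m‖ ^ 2 - ‖x i m‖ ^ 2) ≤ ∑ m, 2 * (‖a m‖ ^ 2 - inner ℝ (a m) (x i m)) := by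
      refine Finset.sum_le_sum fun m _ => ?_
      have := norm_sub_sq_real (a m) (x i m)
      nlinarith [sq_nonneg ‖a m - x i m‖]
    rw [Finset.sum_sub_distrib] at h2
    have h3 := norm_sub_sq_real (z i) b
    rw [real_inner_comm] at h3
    linarith [hle i]
  have h2 : Tendsto (fun i => 2 * (‖b‖ ^ 2 - inner ℝ b (z i))
      + ∑ m, 2 * (‖a m‖ ^ 2 - inner ℝ (a m) (x i m))) 𝒰 (𝓝 0) := by
    have e : (0 : ℝ) = 2 * (‖b‖ ^ 2 - inner ℝ b c)
        + ∑ m, 2 * (‖a m‖ ^ 2 - inner ℝ (a m) (a m)) := by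
      simp [hbc]
    rw [e]
    refine ((tendsto_const_nhds.sub (hc b)).const_mul 2).add
      (tendsto_finsetSum _ fun m _ => ?_)
    exact (tendsto_const_nhds.sub ((hx m).mono h𝒰 (a m))).const_mul 2
  rw [tendsto_iff_norm_sub_tendsto_zero]
  have h3 : Tendsto (fun i => ‖z i - b‖ ^ 2) 𝒰 (𝓝 0) :=
    squeeze_zero (fun i => by positivity) h1 h2
  have h4 := (Real.continuous_sqrt.tendsto 0).comp h3
  simpa [Function.comp_def, Real.sqrt_sq (norm_nonneg _)] using h4

end Optimization

/-! ### The learning problem -/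

section Learning

variable {d Q p : ℕ} {𝓨 : Set (E d)}
variable {HU HP : Type*}
  [NormedAddCommGroup HU] [InnerProductSpace ℝ HU] [RKHS ℝ HU 𝓨 ℝ]
  [NormedAddCommGroup HP] [InnerProductSpace ℝ HP] [RKHS ℝ HP (E (d + Q)) ℝ]
  {L : Fin Q → DiffOp 𝓨 p} {Pbar : E (d + Q) → ℝ} {u f : ℕ → 𝓨 → ℝ} {Y : ℕ → ℕ → Finset 𝓨}

/-- The union of the curves `Φ(u^m, 𝓨)`, `m < M`. -/
def graphPoints (L : Fin Q → DiffOp 𝓨 p) (u : ℕ → 𝓨 → ℝ) (M : ℕ) : Set (E (d + Q)) :=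
  ⋃ m < M, Set.range (Phi L (u m))

lemma graphPoints_mono (L : Fin Q → DiffOp 𝓨 p) (u : ℕ → 𝓨 → ℝ) : Monotone (graphPoints L u) :=
  fun _ _ h => Set.biUnion_subset_biUnion_left fun _ hm => lt_of_lt_of_le hm h

lemma dataPoints_subset_graphPoints (L : Fin Q → DiffOp 𝓨 p) (u : ℕ → 𝓨 → ℝ)
    (Y : ℕ → ℕ → Finset 𝓨) (M N : ℕ) : dataPoints L u Y M N ⊆ graphPoints L u M :=
  Set.iUnion₂_mono fun _ _ => Set.image_subset_range _ _

/-- The closed span of the representers of the points of `S`. -/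
noncomputable def kerSpan (H : Type*) {X : Type*} [NormedAddCommGroup H] [InnerProductSpace ℝ H]
    [CompleteSpace H] [RKHS ℝ H X ℝ] (S : Set X) : Submodule ℝ H :=
  (Submodule.span ℝ (kerVec H '' S)).topologicalClosure

instance {H : Type*} {X : Type*} [NormedAddCommGroup H] [InnerProductSpace ℝ H]
    [CompleteSpace H] [RKHS ℝ H X ℝ] (S : Set X) : (kerSpan H S).HasOrthogonalProjection :=
  inferInstanceAs (Submodule.topologicalClosure _).HasOrthogonalProjection

lemma kerVec_mem_kerSpan {H : Type*} {X : Type*} [NormedAddCommGroup H] [InnerProductSpace ℝ H]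
    [CompleteSpace H] [RKHS ℝ H X ℝ] {S : Set X} {s : X} (hs : s ∈ S) :
    kerVec H s ∈ kerSpan H S :=
  Submodule.le_topologicalClosure _ (Submodule.subset_span ⟨s, hs, rfl⟩)

lemma kerSpan_mono {H : Type*} {X : Type*} [NormedAddCommGroup H] [InnerProductSpace ℝ H]
    [CompleteSpace H] [RKHS ℝ H X ℝ] {S T : Set X} (h : S ⊆ T) : kerSpan H S ≤ kerSpan H T :=
  Submodule.topologicalClosure_mono (Submodule.span_mono (Set.image_mono h))

/-- Comparison of a minimizer with exact solutions. -/
lemma IsMinimizer.norm_sq_add_le {P : HP} {M N : ℕ}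
    (hpde : ∀ m y, Pbar (Phi L (u m) y) + P (Phi L (u m) y) = f m y)
    {x : Fin M → HU} {z : HP} (hmin : IsMinimizer HU HP L Pbar u f Y M N (x, z))
    {a : Fin M → HU} (ha : ∀ m : Fin M, (a m : 𝓨 → ℝ) = u m) {b : HP}
    (hb : ∀ s ∈ graphPoints L u M, b s = P s) :
    ‖z‖ ^ 2 + ∑ m, ‖x m‖ ^ 2 ≤ ‖b‖ ^ 2 + ∑ m, ‖a m‖ ^ 2 := by
  refine (isMinOn_iff.1 hmin.2) (a, b) ⟨fun m y _ => by simp only [ha m], fun m y _ => ?_⟩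
  simp only [ha m]
  rw [hb _ (Set.mem_biUnion (show (m : ℕ) ∈ {i | i < M} from m.2) ⟨y, rfl⟩), ← hpde]
  ring

lemma norm_le_sqrt_of_sq_add_sum_le {H G : Type*} [NormedAddCommGroup H] [NormedAddCommGroup G]
    {κ : Type*} [Fintype κ] {x : κ → H} {z : G} {R : ℝ} (h : ‖z‖ ^ 2 + ∑ m, ‖x m‖ ^ 2 ≤ R) :
    ‖z‖ ≤ √R ∧ ∀ m, ‖x m‖ ≤ √R := by
  have h1 : 0 ≤ ∑ m, ‖x m‖ ^ 2 := Finset.sum_nonneg fun m _ => by positivity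
  refine ⟨Real.le_sqrt_of_sq_le (by linarith), fun m => Real.le_sqrt_of_sq_le ?_⟩
  have := Finset.single_le_sum (f := fun m => ‖x m‖ ^ 2) (fun m _ => by positivity)
    (Finset.mem_univ m)
  nlinarith [sq_nonneg ‖z‖]

variable [CompleteSpace HU]

/-- The state components of the minimizers converge weakly to the data. -/
lemma weakTendsto_state {P : HP} {M : ℕ}
    (hU_cont : Continuous fun y : 𝓨 × 𝓨 => rkhsKernel HU y.1 y.2)
    (hpde : ∀ m y, Pbar (Phi L (u m) y) + P (Phi L (u m) y) = f m y)
    (hρ : ∀ m, Tendsto (fun N => fillDistance 𝓨 (Subtype.val '' (Y m N : Set 𝓨))) atTop (𝓝 0))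
    {x : ℕ → Fin M → HU} {z : ℕ → HP}
    (hmin : ∀ N, IsMinimizer HU HP L Pbar u f Y M N (x N, z N))
    {a : Fin M → HU} (ha : ∀ m : Fin M, (a m : 𝓨 → ℝ) = u m) (m : Fin M) :
    WeakTendsto (fun N => x N m) atTop (a m) := by
  have hR := fun N =>
    (norm_le_sqrt_of_sq_add_sum_le ((hmin N).norm_sq_add_le hpde ha fun _ _ => rfl)).2 m
  exact weakTendsto_of_pointwise hR (tendsto_apply_of_interpolation hU_cont (hρ m) hR
    fun N y hy => by rw [ha]; exact (hmin N).1.1 m y hy)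

variable [CompleteSpace HP]

/-- The weak limits of the equation components of the minimizers solve the equation. -/
lemma apply_eq_of_weakTendsto (h𝓨_open : IsOpen 𝓨) (hPbar : Continuous Pbar)
    (hU_cont : Continuous fun y : 𝓨 × 𝓨 => rkhsKernel HU y.1 y.2)
    {γ : ℕ} (hγ : (d : ℝ) / 2 + p < γ) {ιU : HU →L[ℝ] SobolevSpace γ 𝓨}
    (hιU : IsCompactOperator ιU) (hιU' : ∀ v : HU, Represents (ιU v) (ext0 (v : 𝓨 → ℝ)))
    {η : ℕ} (hη : ((Q : ℝ) + d) / 2 < η) (hP_cont : ∀ G : HP, Continuous (G : E (d + Q) → ℝ))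
    {ιP : HP →L[ℝ] SobolevSpace η (Set.univ : Set (E (d + Q)))}
    (hιP : IsCompactOperator ιP) (hιP' : ∀ G : HP, Represents (ιP G) (G : E (d + Q) → ℝ))
    {P : HP} {M : ℕ} (hpde : ∀ m y, Pbar (Phi L (u m) y) + P (Phi L (u m) y) = f m y)
    (hρ : ∀ m, Tendsto (fun N => fillDistance 𝓨 (Subtype.val '' (Y m N : Set 𝓨))) atTop (𝓝 0))
    {x : ℕ → Fin M → HU} {z : ℕ → HP}
    (hmin : ∀ N, IsMinimizer HU HP L Pbar u f Y M N (x N, z N))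
    {a : Fin M → HU} (ha : ∀ m : Fin M, (a m : 𝓨 → ℝ) = u m)
    {𝒰 : Ultrafilter ℕ} (h𝒰 : ↑𝒰 ≤ (atTop : Filter ℕ)) {c : HP} (hc : WeakTendsto z 𝒰 c) :
    ∀ s ∈ graphPoints L u M, c s = P s := by
  intro s hs
  simp only [graphPoints, Set.mem_iUnion, Set.mem_range] at hs
  obtain ⟨m, hm, y, rfl⟩ := hs
  obtain ⟨t, ht, htY⟩ := exists_tendsto_of_fillDistance (hρ m) y
  have hcont := continuous_of_continuous_kernel (H := HU) hU_cont
  have hR := fun N =>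
    norm_le_sqrt_of_sq_add_sum_le ((hmin N).norm_sq_add_le hpde ha fun _ _ => rfl)
  have hΦ₀ : Tendsto (fun N => Phi L (a ⟨m, hm⟩) (t N)) atTop (𝓝 (Phi L (a ⟨m, hm⟩) y)) :=
    tendsto_Phi h𝓨_open hγ L (fun _ => hcont _) (fun _ => hιU' _) (hcont _) (hιU' _)
      tendsto_const_nhds ht
  have hΦ : Tendsto (fun N => Phi L (x N ⟨m, hm⟩) (t N)) atTop (𝓝 (Phi L (a ⟨m, hm⟩) y)) :=
    tendsto_Phi h𝓨_open hγ L (fun _ => hcont _) (fun _ => hιU' _) (hcont _) (hιU' _)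
      ((weakTendsto_state hU_cont hpde hρ hmin ha ⟨m, hm⟩).compact hιU fun N => (hR N).2 _) ht
  have e : Phi L (a ⟨m, hm⟩) = Phi L (u m) := by rw [ha]
  rw [e] at hΦ₀ hΦ
  -- Evaluation at moving points: compactness gives convergence in `H^η`, and `η > (d + Q)/2` gives
  -- locally uniform convergence, the case of order zero.
  have h1 : Tendsto (fun N => z N (Phi L (x N ⟨m, hm⟩) (t N))) 𝒰 (𝓝 (c (Phi L (u m) y))) := by
    have hη' : ((d + Q : ℕ) : ℝ) / 2 + (0 : ℕ) < η := by push_cast; linarith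
    have := tendsto_multiDeriv isOpen_univ hη' (fun N => (hP_cont (z N)).continuousOn)
      (fun N => hιP' (z N)) (hP_cont c).continuousOn (hιP' c)
      (hc.compact hιP fun N => (hR N).1) (zeroIdx (d + Q) 0).2 (Set.mem_univ _)
      (hΦ.mono_left h𝒰)
    simpa only [zeroIdx, multiDeriv_zero] using this
  -- No continuity of `f m` is assumed: by the equation `f m (t N)` is `Pbar + P` at `Phi L (u m) (t
  -- N)`, and the two `Pbar` terms cancel in the limit.
  have h2 : Tendsto (fun N => f m (t N) - Pbar (Phi L (x N ⟨m, hm⟩) (t N))) atTop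
      (𝓝 (P (Phi L (u m) y))) := by
    have h3 := (((hPbar.tendsto _).comp hΦ₀).add (((hP_cont P).tendsto _).comp hΦ₀)).sub
      ((hPbar.tendsto _).comp hΦ)
    rw [add_sub_cancel_left] at h3
    exact h3.congr fun N => by simp only [Function.comp_apply, hpde]
  refine tendsto_nhds_unique (h1.congr' ?_) (h2.mono_left h𝒰)
  filter_upwards [h𝒰 htY] with N hN
  exact (hmin N).1.2 ⟨m, hm⟩ (t N) (Set.mem_biUnion (show m ∈ {i | i < M} from hm) hN)

end Learning

end KEqL

/-! ### Convergence of the learned states and of the learned equation -/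

theorem mainTheorem5
    {d Q p : ℕ} {𝓨 : Set (E d)}
    -- the domain
    (h𝓨_open : IsOpen 𝓨) (h𝓨_bdd : Bornology.IsBounded 𝓨) (h𝓨_lip : HasLipschitzBoundary 𝓨)
    -- the RKHS `HU` of the kernel `𝖴` on `𝓨`, and the RKHS `HP` of the kernel `𝖯` on `ℝ^{d + Q}`
    {HU HP : Type*}
    [NormedAddCommGroup HU] [InnerProductSpace ℝ HU] [CompleteSpace HU] [RKHS ℝ HU 𝓨 ℝ]
    [NormedAddCommGroup HP] [InnerProductSpace ℝ HP] [CompleteSpace HP]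
    [RKHS ℝ HP (E (d + Q)) ℝ]
    -- the PDE: differential operators of order at most `p`, known part, boundary condition
    (L : Fin Q → DiffOp 𝓨 p)
    (Pbar : E (d + Q) → ℝ) (hPbar : Continuous Pbar)
    (bdryOp : (𝓨 → ℝ) → frontier 𝓨 → ℝ) (g : frontier 𝓨 → ℝ)
    -- assumptions on `𝖴`
    (hU_cont : Continuous fun y : 𝓨 × 𝓨 => rkhsKernel HU y.1 y.2)
    (γ : ℕ) (hγ : (d : ℝ) / 2 + p < γ)
    (hU_emb : CompactlyEmbedded (fun v : HU => ext0 (v : 𝓨 → ℝ)) γ 𝓨)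
    (hU_bdry : ∀ v : HU, bdryOp v = g)
    -- assumptions on `𝖯`
    (η : ℕ) (hη : ((Q : ℝ) + d) / 2 < η)
    (hP_cont : ∀ G : HP, Continuous (G : E (d + Q) → ℝ))
    (hP_emb : CompactlyEmbedded (fun G : HP => (G : E (d + Q) → ℝ)) η Set.univ)
    -- the unknown part of the PDE and the training pairs
    (P : HP) (u f : ℕ → 𝓨 → ℝ)
    (hpde : ∀ m y, Pbar (Phi L (u m) y) + P (Phi L (u m) y) = f m y)
    (hbdry : ∀ m, bdryOp (u m) = g)
    -- the observation points and the set `B`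
    (Y : ℕ → ℕ → Finset 𝓨) (B : Set (E (d + Q)))
    (hB_open : IsOpen B) (hB_bdd : Bornology.IsBounded B) (hB_lip : HasLipschitzBoundary B)
    -- the fill distances tend to zero
    (hρ : ∀ m, Tendsto (fun N => fillDistance 𝓨 (Subtype.val '' (Y m N : Set 𝓨))) atTop (𝓝 0))
    (hϱ : Tendsto (fun q : ℕ × ℕ => fillDistance B (dataPoints L u Y q.1 q.2 ∩ B)) atTop (𝓝 0)) :
    -- (a)
    (∀ (M : ℕ) (uhat : ℕ → Fin M → HU) (Phat : ℕ → HP),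
      (∀ N, IsMinimizer HU HP L Pbar u f Y M N (uhat N, Phat N)) →
      (∀ m : Fin M, ∃ v : HU, (v : 𝓨 → ℝ) = u m) →
      ∀ m : Fin M,
        (∀ y : 𝓨, Tendsto (fun N => uhat N m y) atTop (𝓝 (u m y))) ∧
        ∀ γ' : ℕ, γ' < γ →
          Tendsto (fun N => sobolevENorm γ' 𝓨 (ext0 fun y => uhat N m y - u m y)) atTop (𝓝 0)) ∧
    -- (b)
    (∀ (uhat : ∀ M : ℕ, ℕ → Fin M → HU) (Phat : ℕ → ℕ → HP),
      (∀ M N, IsMinimizer HU HP L Pbar u f Y M N (uhat M N, Phat M N)) →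
      (∀ m, u m ∈ powerSpace (rkhsKernel HU) 2) →
      ∃ Plim : ℕ → E (d + Q) → ℝ,
        ((∀ M, ∀ s ∈ B, Tendsto (fun N => Phat M N s) atTop (𝓝 (Plim M s))) ∧
          ∀ s ∈ B, Tendsto (fun M => Plim M s) atTop (𝓝 (P s))) ∧
        ∀ η' : ℕ, η' < η →
          (∀ M, Tendsto (fun N => sobolevENorm η' B fun s => Phat M N s - Plim M s)
            atTop (𝓝 0)) ∧
          Tendsto (fun M => sobolevENorm η' B fun s => Plim M s - P s) atTop (𝓝 0)) := by

  obtain ⟨ιU, hιU, hιU'⟩ := hU_emb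
  obtain ⟨ιP, hιP, hιP'⟩ := hP_emb
  constructor
  · intro M uhat Phat hmin hu
    choose a ha using hu
    intro m
    have hw := weakTendsto_state hU_cont hpde hρ hmin ha m
    have hR := fun N =>
      (norm_le_sqrt_of_sq_add_sum_le ((hmin N).norm_sq_add_le hpde ha fun _ _ => rfl)).2 m
    refine ⟨fun y => ?_, fun γ' hγ' => ?_⟩
    · rw [← ha m]
      exact hw.apply y
    · have := tendsto_sobolevENorm hγ'.le h𝓨_open subset_rfl hιU' (hw.compact hιU hR)
      simpa only [← ha m, ext0_sub] using this
  · intro uhat Phat hmin hu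
    choose a ha using fun m => exists_eq_of_mem_powerSpace (hu m)
    set V : ℕ → Submodule ℝ HP := fun M => kerSpan HP (graphPoints L u M) with hV
    have hVmono : Monotone V := fun _ _ h => kerSpan_mono (graphPoints_mono L u h)
    have hVP : ∀ M, ∀ s ∈ graphPoints L u M, (V M).starProjection P s = P s := fun M s hs =>
      starProjection_span_kerVec_apply (fun s hs => kerVec_mem_kerSpan hs) P hs
    -- The competitor is now `(u, π_M P)` instead of `(u, P)`; this sharper bound singles out the
    -- limit.
    have hN : ∀ M, Tendsto (Phat M) atTop (𝓝 ((V M).starProjection P)) := by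
      intro M
      have ha' : ∀ m : Fin M, (a m : 𝓨 → ℝ) = u m := fun m => ha m
      refine tendsto_of_norm_sq_add_le
        (fun N => (hmin M N).norm_sq_add_le hpde ha' (hVP M))
        (weakTendsto_state hU_cont hpde hρ (hmin M) ha')
        (fun N => (norm_le_sqrt_of_sq_add_sum_le
          ((hmin M N).norm_sq_add_le hpde ha' (hVP M))).1)
        fun 𝒰 h𝒰 c hc => ?_
      have hcP := apply_eq_of_weakTendsto h𝓨_open hPbar hU_cont hγ hιU hιU' hη hP_cont hιP hιP'
        hpde hρ (hmin M) ha' h𝒰 hc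
      -- Both functions equal `P` on `graphPoints L u M`, so their difference is orthogonal to all
      -- the representers there.
      have hort : c - (V M).starProjection P ∈ (V M)ᗮ :=
        mem_orthogonal_span_kerVec fun s hs => by
          rw [RKHS.coe_sub, Pi.sub_apply, hcP s hs, hVP M s hs, sub_self]
      have := (Submodule.mem_orthogonal _ _).1 hort _ ((V M).starProjection_apply_mem P)
      rw [inner_sub_right, real_inner_self_eq_norm_sq, sub_eq_zero] at this
      exact this
    have hM := Submodule.starProjection_tendsto_closure_iSup V hVmono P
    set Pinf : HP := (⨆ M, V M).topologicalClosure.starProjection P with hPinf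
    have hPB : ∀ s ∈ B, Pinf s = P s := by
      have hcl : IsClosed {s | Pinf s = P s} := isClosed_eq (hP_cont _) (hP_cont _)
      have hsub : ∀ M, graphPoints L u M ⊆ {s | Pinf s = P s} := fun M s hs =>
        starProjection_span_kerVec_apply (S := graphPoints L u M)
          (fun s hs => Submodule.le_topologicalClosure _
            (Submodule.mem_iSup_of_mem M (kerVec_mem_kerSpan hs))) P hs
      intro s hs
      refine hcl.closure_subset ?_
      -- The data points lie in the coincidence set, so the distance of `s` to that set is at most
      -- every fill distance, and these tend to zero.
      rw [Metric.mem_closure_iff_infEDist_zero, ← nonpos_iff_eq_zero]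
      refine ge_of_tendsto hϱ (Eventually.of_forall fun q => ?_)
      refine le_trans ?_ (le_iSup₂ (f := fun (y : E (d + Q)) (_ : y ∈ B) =>
        Metric.infEDist y (dataPoints L u Y q.1 q.2 ∩ B)) s hs)
      exact Metric.infEDist_anti
        (Set.inter_subset_left.trans ((dataPoints_subset_graphPoints L u Y _ _).trans (hsub _)))
    refine ⟨fun M => (V M).starProjection P, ⟨fun M s _ => ?_, fun s hs => ?_⟩, fun η' hη' =>
      ⟨fun M => ?_, ?_⟩⟩
    · exact ((RKHS.continuous_eval s).tendsto _).comp (hN M)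
    · rw [← hPB s hs]
      exact ((RKHS.continuous_eval s).tendsto _).comp hM
    · exact tendsto_sobolevENorm hη'.le isOpen_univ (Set.subset_univ B) hιP'
        ((ιP.continuous.tendsto _).comp (hN M))
    -- The limit in `𝓟` is `Pinf`, which is known to equal `P` only on `B`; the Sobolev norm on `B`
    -- does not see the difference.
    · refine (tendsto_sobolevENorm hη'.le isOpen_univ (Set.subset_univ B) hιP'
        ((ιP.continuous.tendsto _).comp hM)).congr fun M => ?_
      exact sobolevENorm_congr hB_open.measurableSet fun s hs => by rw [hPB s hs]
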